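/- **Setting.** A *continuity modulus* is an increasing left-continuous function $\delta\colon(0,\infty)\to(0,\infty)$. A *gauge* on a metric space $(X,d)$ is a $1$-Lipschitz function $\nu\colon X\to\mathbb R^+=[0,\infty)$ such that every set $\{\nu\le r\}$ is bounded. Finite products carry the maximum metric and the maximum gauge ($0$ for the empty product), and $\mathbb R^+$ is gauged by the identity. A map $f$ between gauged spaces *respects* $\delta$ *under* $\nu$ if for all $\varepsilon>0$: $\nu(x),\nu(y)<\frac1\varepsilon$ and $d(x,y)<\delta(\varepsilon)$ imply $d(f(x),f(y))\le\varepsilon$ and $\nu(f(x))\le\frac1{\delta(\varepsilon)}$. An *unbounded signature* $\mathcal L$ (possibly many-sorted) consists of function and predicate symbols, including for each sort a binary distance symbol $d$ and a unary gauge symbol $\nu$, each symbol $s$ with a continuity modulus $\delta_s$. An *$\mathcal L$-structure* $M$ is given by a complete gauged metric space (possibly empty) $(M,d,\nu)$ for each sort, with function symbols interpreted by maps between products of sorts and predicate symbols by $\mathbb R^+$-valued maps, every symbol $s$ (including $d$ and $\nu$) respecting $\delta_s$ under $\nu$. Formulae are built from atomic formulae with the connectives $1$, $x\mathbin{\dot-}y=\max(x-y,0)$,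 $x+y$, $x/2$ and with quantifiers $\sup_x\varphi$, $\inf_x\varphi$, which are allowed only if $\varphi$ is syntactically eventually constant in $x$. Here (i) an atomic formula is never bounded, and is eventually constant in $x$ iff $x$ does not appear in it; (ii) combining by connectives formulae that are all bounded (respectively, eventually constant in $x$) gives such a formula, as does quantification over another variable; (iii) if $\varphi$ is bounded then $\varphi\mathbin{\dot-}\psi$ is bounded for every $\psi$, and $\varphi\mathbin{\dot-}\nu(x)$ is eventually constant in $x$; (iv) $\sup_x\varphi$ and $\inf_x\varphi$ are bounded if $\varphi$ is. Formulae are interpreted in $M$ in the natural way, except that quantifiers range over $M\cup\{\infty\}$: $(\sup_x\varphi(x,\bar a))^M=\sup_{b\in M\cup\{\infty\}}\varphi^M(b,\bar a)$, and similarly for $\inf$, where $\varphi(\infty,\bar y)$ is $\varphi$ if $x$ is not free in $\varphi$, is $0$ if $\varphi=\psi\mathbin{\dot-}\nu(x)$ with $\psi$ bounded, and is otherwise obtained by commuting the substitution of $\infty$ with connectives and with quantifiers over other variables. A *condition* is an expression $\varphi\le r$ with $r\in\mathbb R$; a set of conditions in the variables $x_{<n}=(x_0,\dots,x_{n-1})$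 (of given sorts) is *satisfiable* if all its members hold for one tuple in one structure. It is *approximately finitely satisfiable* if for every finite subset $\{\varphi_i\le r_i:i\in w\}$ and every $\varepsilon>0$ the set $\{\varphi_i\le r_i+\varepsilon:i\in w\}$ is satisfiable. A *theory* $T$ is a set of conditions without free variables. The type of a tuple is the set of all conditions in $x_{<n}$ that it satisfies, and $S_n(T)$ is the set of types of $n$-tuples (of given sorts) in models of $T$, with the *logic topology*, for which the sets $\{p: c\in p\}$, $c$ a condition, form a base of closed sets. **Statement (bounded compactness).** Let $\mathcal L$ be an unbounded signature. 1. Let $r\in\mathbb R^+$, $n\in\mathbb N$, and let $\Sigma$ be a set of conditions in the free variables $x_{<n}$. Then $\Sigma\cup\{\nu(x_i)\le r: i<n\}$ is satisfiable if and only if it is approximately finitely satisfiable. 2. For every $\mathcal L$-theory $T$ and every $n\in\mathbb N$, the type space $S_n(T)$ is locally compact. -/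

import Mathlib

open scoped NNReal

universe u

noncomputable section

namespace UnboundedLogic

/-! ### Gauged spaces and continuity moduli -/

/-- A continuity modulus: an increasing, left-continuous function `(0,∞) → (0,∞)`
(values outside `(0,∞)` are irrelevant). -/
structure Modulus where
  toFun : ℝ → ℝ
  pos : ∀ ε, 0 < ε → 0 < toFun ε
  mono : ∀ ε ε', 0 < ε → ε ≤ ε' → toFun ε ≤ toFun ε'
  left_cont : ∀ ε, 0 < ε → IsLUB (toFun '' Set.Ioo 0 ε) (toFun ε)

/-- `ν` is a gauge on the metric space `X`: it is `1`-Lipschitz and every `ν`-ball is bounded. -/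
structure IsGauge {X : Type*} [MetricSpace X] (ν : X → ℝ≥0) : Prop where
  lipschitz : LipschitzWith 1 ν
  bounded : ∀ r : ℝ, Bornology.IsBounded {x | (ν x : ℝ) ≤ r}

/-- The map `f : (X, d, νX) → (Y, d, νY)` respects the modulus `δ` under `ν`. -/
def Respects (δ : Modulus) {X Y : Type*} [MetricSpace X] [MetricSpace Y]
    (νX : X → ℝ≥0) (νY : Y → ℝ≥0) (f : X → Y) : Prop :=
  ∀ ε : ℝ, 0 < ε → ∀ x y : X,
    (νX x : ℝ) < ε⁻¹ → (νX y : ℝ) < ε⁻¹ → dist x y < δ.toFun ε →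
      dist (f x) (f y) ≤ ε ∧ (νY (f x) : ℝ) ≤ (δ.toFun ε)⁻¹

/-- The gauge of a finite product: the maximum of the gauges (`0` for the empty product).
The metric on a finite product is Mathlib's, the maximum of the distances. -/
def prodGauge {n : ℕ} {X : Fin n → Type*} (ν : ∀ i, X i → ℝ≥0) (x : ∀ i, X i) : ℝ≥0 :=
  Finset.univ.sup fun i => ν i (x i)

/-! ### Signatures and structures -/

/-- An unbounded continuous signature, possibly many-sorted.  `Rel` and `Fn` are the
non-distinguished predicate and function symbols, with the sorts of their arguments (and of
their values).  Each symbol, including the distinguished distance and gauge symbols of each sort,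
carries a continuity modulus. -/
structure Signature where
  Sorts : Type u
  Fn : Type u
  Rel : Type u
  fnArity : Fn → ℕ
  fnDom : ∀ f : Fn, Fin (fnArity f) → Sorts
  fnCod : Fn → Sorts
  relArity : Rel → ℕ
  relDom : ∀ R : Rel, Fin (relArity R) → Sorts
  fnMod : Fn → Modulus
  relMod : Rel → Modulus
  distMod : Sorts → Modulus
  gaugeMod : Sorts → Modulus

/-- An unbounded `L`-structure: each sort is a complete gauged metric space, possibly empty, and
every symbol (the distance and gauge symbols included) is interpreted by a map that respects its
modulus under `ν`; `ℝ≥0` is gauged by the identity. -/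
structure UStructure (L : Signature.{u}) where
  carrier : L.Sorts → Type u
  [metric : ∀ s, MetricSpace (carrier s)]
  [complete : ∀ s, CompleteSpace (carrier s)]
  nu : ∀ s, carrier s → ℝ≥0
  isGauge : ∀ s, IsGauge (nu s)
  fn : ∀ f : L.Fn, (∀ i, carrier (L.fnDom f i)) → carrier (L.fnCod f)
  rel : ∀ R : L.Rel, (∀ i, carrier (L.relDom R i)) → ℝ≥0
  fn_respects : ∀ f : L.Fn,
    Respects (L.fnMod f) (prodGauge fun i => nu (L.fnDom f i)) (nu (L.fnCod f)) (fn f)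
  rel_respects : ∀ R : L.Rel,
    Respects (L.relMod R) (prodGauge fun i => nu (L.relDom R i)) id (rel R)
  dist_respects : ∀ s : L.Sorts,
    Respects (L.distMod s) (prodGauge fun _ : Fin 2 => nu s) id
      (fun x : Fin 2 → carrier s => nndist (x 0) (x 1))
  gauge_respects : ∀ s : L.Sorts,
    Respects (L.gaugeMod s) (prodGauge fun _ : Fin 1 => nu s) id
      (fun x : Fin 1 → carrier s => nu s (x 0))

attribute [instance] UStructure.metric UStructure.complete

/-! ### Terms and formulae

Terms and formulae are taken over a context `σ : Fin n → L.Sorts`: the variables available are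
`x₀, …, x_{n-1}`, with `xᵢ` of sort `σ i`. -/

/-- Terms of sort `s` in the variables of the context `σ`. -/
inductive Term (L : Signature.{u}) {n : ℕ} (σ : Fin n → L.Sorts) : L.Sorts → Type u
  | var (i : Fin n) : Term L σ (σ i)
  | app (f : L.Fn) (ts : ∀ i, Term L σ (L.fnDom f i)) : Term L σ (L.fnCod f)

/-- The variable `xᵢ` appears in the term. -/
def Term.Occurs {L : Signature.{u}} {n : ℕ} {σ : Fin n → L.Sorts} (i : Fin n) :
    {s : L.Sorts} → Term L σ s → Prop
  | _, .var j => i = j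
  | _, .app _ ts => ∃ k, (ts k).Occurs i

/-- The context `σ` with a new variable of sort `s` put in front, as the variable `0`; the old
variable `i` becomes `i.succ`. -/
def extend {S : Type u} {n : ℕ} (s : S) (σ : Fin n → S) : Fin (n + 1) → S :=
  Fin.cases s σ

/-- Expressions built from atomic formulae by the connectives `1`, `x ∸ y`, `x + y`, `x / 2` and by
quantifiers, without the restriction on quantification.  A quantifier binds the variable `0`. -/
inductive PreFormula (L : Signature.{u}) : {n : ℕ} → (Fin n → L.Sorts) → Type u
  | rel {n : ℕ} {σ : Fin n → L.Sorts} (R : L.Rel) (ts : ∀ i, Term L σ (L.relDom R i)) :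
      PreFormula L σ
  | dist {n : ℕ} {σ : Fin n → L.Sorts} {s : L.Sorts} (t t' : Term L σ s) : PreFormula L σ
  | gauge {n : ℕ} {σ : Fin n → L.Sorts} {s : L.Sorts} (t : Term L σ s) : PreFormula L σ
  | one {n : ℕ} {σ : Fin n → L.Sorts} : PreFormula L σ
  | sub {n : ℕ} {σ : Fin n → L.Sorts} (φ ψ : PreFormula L σ) : PreFormula L σ
  | add {n : ℕ} {σ : Fin n → L.Sorts} (φ ψ : PreFormula L σ) : PreFormula L σ
  | half {n : ℕ} {σ : Fin n → L.Sorts} (φ : PreFormula L σ) : PreFormula L σ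
  | sup {n : ℕ} {σ : Fin n → L.Sorts} (s : L.Sorts) (φ : PreFormula L (extend s σ)) :
      PreFormula L σ
  | inf {n : ℕ} {σ : Fin n → L.Sorts} (s : L.Sorts) (φ : PreFormula L (extend s σ)) :
      PreFormula L σ

namespace PreFormula

variable {L : Signature.{u}}

/-- The expression is syntactically bounded. -/
def Bounded : {n : ℕ} → {σ : Fin n → L.Sorts} → PreFormula L σ → Prop
  | _, _, .rel _ _ => False
  | _, _, .dist _ _ => False
  | _, _, .gauge _ => False
  | _, _, .one => True
  | _, _, .sub φ _ => φ.Bounded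
  | _, _, .add φ ψ => φ.Bounded ∧ ψ.Bounded
  | _, _, .half φ => φ.Bounded
  | _, _, .sup _ φ => φ.Bounded
  | _, _, .inf _ φ => φ.Bounded

/-- The expression is syntactically eventually constant in the variable `xᵢ`. -/
def EventuallyConst : {n : ℕ} → {σ : Fin n → L.Sorts} → (i : Fin n) → PreFormula L σ → Prop
  | _, _, i, .rel _ ts => ∀ k, ¬ (ts k).Occurs i
  | _, _, i, .dist t t' => ¬ t.Occurs i ∧ ¬ t'.Occurs i
  | _, _, i, .gauge t => ¬ t.Occurs i
  | _, _, _, .one => True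
  | _, _, i, .sub φ ψ =>
      (φ.EventuallyConst i ∧ ψ.EventuallyConst i) ∨ (φ.Bounded ∧ ψ = .gauge (.var i))
  | _, _, i, .add φ ψ => φ.EventuallyConst i ∧ ψ.EventuallyConst i
  | _, _, i, .half φ => φ.EventuallyConst i
  | _, _, i, .sup _ φ => φ.EventuallyConst i.succ
  | _, _, i, .inf _ φ => φ.EventuallyConst i.succ

/-- The expression is a formula: every quantifier is applied to an expression that is eventually
constant in the quantified variable. -/
def IsFormula : {n : ℕ} → {σ : Fin n → L.Sorts} → PreFormula L σ → Prop
  | _, _, .rel _ _ => True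
  | _, _, .dist _ _ => True
  | _, _, .gauge _ => True
  | _, _, .one => True
  | _, _, .sub φ ψ => φ.IsFormula ∧ ψ.IsFormula
  | _, _, .add φ ψ => φ.IsFormula ∧ ψ.IsFormula
  | _, _, .half φ => φ.IsFormula
  | _, _, .sup _ φ => φ.IsFormula ∧ φ.EventuallyConst 0
  | _, _, .inf _ φ => φ.IsFormula ∧ φ.EventuallyConst 0

end PreFormula

/-- Formulae of unbounded continuous logic with free variables among those of `σ`. -/
def Formula (L : Signature.{u}) {n : ℕ} (σ : Fin n → L.Sorts) : Type u :=
  {φ : PreFormula L σ // φ.IsFormula}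

/-! ### Semantics

The variables take values in `M ∪ {∞}`, that is in `Option (M.carrier s)`, with `none` for `∞`. -/

/-- A tuple of elements of `A i ∪ {∞}`, read as a tuple of elements if no entry is `∞`. -/
def allSome {n : ℕ} {A : Fin n → Type u} (x : ∀ i, Option (A i)) : Option (∀ i, A i) :=
  open Classical in
  if h : ∀ i, (x i).isSome then some fun i => (x i).get (h i) else none

/-- The value of a term; `∞` if a variable with value `∞` appears in it. -/
def Term.eval {L : Signature.{u}} (M : UStructure L) {n : ℕ} {σ : Fin n → L.Sorts}
    (v : ∀ i, Option (M.carrier (σ i))) : {s : L.Sorts} → Term L σ s → Option (M.carrier s)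
  | _, .var i => v i
  | _, .app f ts => (allSome fun i => (ts i).eval M v).map (M.fn f)

/-- Extend an assignment for `σ` by a value for the new variable. -/
def extendVal {L : Signature.{u}} (M : UStructure L) {n : ℕ} {σ : Fin n → L.Sorts} {s : L.Sorts}
    (b : Option (M.carrier s)) (v : ∀ i, Option (M.carrier (σ i))) :
    ∀ i, Option (M.carrier (extend s σ i)) :=
  fun i => Fin.cases (motive := fun i => Option (M.carrier (extend s σ i))) b v i

/-- The value of a formula.  The quantifiers range over `M ∪ {∞}`:
`(sup_x φ)(a) = sup_{b ∈ M ∪ {∞}} φ(b, a)`, and similarly for `inf`.  The value `φ(∞, a)` of a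
formula that is eventually constant in `x` is obtained by the rules that `φ(∞, a) = φ(a)` if `x` is
not free in `φ`, that `φ ∸ ν(x)` has the value `0` at `x = ∞`, and that otherwise the substitution of
`∞` commutes with connectives and with quantifiers over other variables.  The value `0` given to an
atomic formula in which a variable with value `∞` appears is a placeholder: it never contributes to
the value of a formula at a tuple of `M`, since such an atomic formula only occurs inside some
`φ ∸ ν(x)` with `x = ∞`. -/
def PreFormula.eval {L : Signature.{u}} (M : UStructure L) : {n : ℕ} → {σ : Fin n → L.Sorts} →
    PreFormula L σ → (∀ i, Option (M.carrier (σ i))) → ℝ≥0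
  | _, _, .rel R ts, v => ((allSome fun i => (ts i).eval M v).map (M.rel R)).getD 0
  | _, _, .dist t t', v =>
      match t.eval M v, t'.eval M v with
      | some a, some b => nndist a b
      | _, _ => 0
  | _, _, .gauge t, v => ((t.eval M v).map (M.nu _)).getD 0
  | _, _, .one, _ => 1
  | _, _, .sub φ ψ, v =>
      open Classical in
      if ∃ i, v i = none ∧ ψ = .gauge (.var i) then 0 else φ.eval M v - ψ.eval M v
  | _, _, .add φ ψ, v => φ.eval M v + ψ.eval M v
  | _, _, .half φ, v => φ.eval M v / 2
  | _, _, .sup s φ, v => ⨆ b : Option (M.carrier s), φ.eval M (extendVal M b v)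
  | _, _, .inf s φ, v => ⨅ b : Option (M.carrier s), φ.eval M (extendVal M b v)

/-- The value `φ(a)` in `M` of a formula at a tuple `a` of elements of `M`. -/
def Formula.value {L : Signature.{u}} (M : UStructure L) {n : ℕ} {σ : Fin n → L.Sorts}
    (φ : Formula L σ) (a : ∀ i, M.carrier (σ i)) : ℝ≥0 :=
  φ.1.eval M fun i => some (a i)

/-! ### Conditions, satisfiability -/

/-- A condition `φ ≤ r` in the variables of `σ`. -/
structure Condition (L : Signature.{u}) {n : ℕ} (σ : Fin n → L.Sorts) where
  formula : Formula L σ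
  bound : ℝ

variable {L : Signature.{u}} {n : ℕ} {σ : Fin n → L.Sorts}

/-- The tuple `a` of `M` satisfies the condition. -/
def Condition.Holds (c : Condition L σ) (M : UStructure L) (a : ∀ i, M.carrier (σ i)) : Prop :=
  (c.formula.value M a : ℝ) ≤ c.bound

/-- The condition `φ ≤ r + ε`. -/
def Condition.relax (c : Condition L σ) (ε : ℝ) : Condition L σ := ⟨c.formula, c.bound + ε⟩

/-- A set of conditions is satisfiable if some tuple in some structure satisfies all of it. -/
def Satisfiable (C : Set (Condition L σ)) : Prop :=
  ∃ (M : UStructure.{u} L) (a : ∀ i, M.carrier (σ i)), ∀ c ∈ C, c.Holds M a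

/-- Approximate finite satisfiability. -/
def ApproxFinitelySatisfiable (C : Set (Condition L σ)) : Prop :=
  ∀ w : Set (Condition L σ), w ⊆ C → w.Finite → ∀ ε : ℝ, 0 < ε →
    Satisfiable ((fun c => c.relax ε) '' w)

/-- The condition `ν(xᵢ) ≤ r`. -/
def gaugeLe (σ : Fin n → L.Sorts) (i : Fin n) (r : ℝ≥0) : Condition L σ :=
  ⟨⟨.gauge (.var i), trivial⟩, r⟩

/-! ### Theories and type spaces -/

/-- A theory: a set of conditions without free variables. -/
abbrev Theory (L : Signature.{u}) : Type u :=
  Set (Condition L (Fin.elim0 : Fin 0 → L.Sorts))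

/-- `M` is a model of `T`. -/
def Theory.Models (T : Theory L) (M : UStructure L) : Prop :=
  ∀ c ∈ T, c.Holds M fun i => i.elim0

/-- The type of a tuple: the set of all conditions that it satisfies. -/
def typeOf (M : UStructure L) (a : ∀ i, M.carrier (σ i)) : Set (Condition L σ) :=
  {c | c.Holds M a}

/-- The space of types, in the variables of `σ`, realised in models of `T`. -/
def TypeSpace (T : Theory L) (σ : Fin n → L.Sorts) : Type u :=
  {p : Set (Condition L σ) //
    ∃ M : UStructure.{u} L, T.Models M ∧ ∃ a : ∀ i, M.carrier (σ i), p = typeOf M a}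

/-- The logic topology: the sets `[c] = {p | c ∈ p}` form a base of closed sets. -/
instance (T : Theory L) (σ : Fin n → L.Sorts) : TopologicalSpace (TypeSpace T σ) :=
  TopologicalSpace.generateFrom {U | ∃ c : Condition L σ, U = {p : TypeSpace T σ | c ∈ p.1}ᶜ}

end UnboundedLogic

end

universe v

noncomputable section

open Filter Topology

namespace UnboundedLogic

variable {L : Signature.{u}} {n : ℕ} {σ : Fin n → L.Sorts}

/-! ### Uniform bounds on the values of terms and formulae -/

/-! Everything rests on an ultraproduct that keeps only the families of bounded gauge, with
distance, gauge and symbols given by limits along the ultrafilter. The moduli belong to the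
signature, so terms and formulae are bounded on sets of bounded gauge uniformly over all structures,
and these limits exist. The definition of respecting a modulus has strict hypotheses and weak
conclusions, so each symbol of the ultraproduct respects the same modulus as in the factors.

The theorem of Łoś (`PreFormula.IsFormula.tendsto_eval`) needs witnesses for quantifiers, and a
family of witnesses may have unbounded gauge. Syntactic eventual constancy repairs this: beyond a
threshold independent of the structure the formula takes its value at `∞`, so far-away witnesses may
be replaced by `∞`, over which quantifiers range as well.

For compactness, the approximate solutions indexed by a finite set of conditions and a tolerance
have tuples of bounded gauge, hence a limit tuple in an ultraproduct. For type spaces, an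
ultrafilter on types of gauge at most `r` converges to the type of the limit of its realisations.
Such sets are thus compact, and they are neighbourhoods of the types of gauge less than `r`. The
space is Hausdorff because `φ ≥ t` is again a condition. -/

theorem allSome_eq_some_iff {A : Fin n → Type u} {x : ∀ i, Option (A i)} {y : ∀ i, A i} :
    allSome x = some y ↔ ∀ i, x i = some (y i) := by
  unfold allSome
  split_ifs with h
  · rw [Option.some_inj, funext_iff]
    exact forall_congr' fun i => by rw [Option.eq_some_iff_get_eq]; simp [h i]
  · simp only [false_iff]
    exact fun hy => h fun i => by simp [hy i]

theorem prodGauge_lt_iff {X : Fin n → Type*} {ν : ∀ i, X i → ℝ≥0} {x : ∀ i, X i} {r : ℝ}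
    (hr : 0 < r) : (prodGauge ν x : ℝ) < r ↔ ∀ i, (ν i (x i) : ℝ) < r := by
  lift r to ℝ≥0 using hr.le
  simp only [NNReal.coe_lt_coe, prodGauge]
  rw [Finset.sup_lt_iff (by simpa using hr)]
  simp

/-- A map that respects a modulus is bounded on sets of bounded gauge. -/
theorem exists_gauge_le_of_respects (δ : Modulus) (K : ℝ) :
    ∃ B : ℝ≥0, ∀ {m : ℕ} {X : Fin m → Type u} {Y : Type v} [∀ i, MetricSpace (X i)]
      [MetricSpace Y] {νX : ∀ i, X i → ℝ≥0} {νY : Y → ℝ≥0} {f : (∀ i, X i) → Y},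
      Respects δ (prodGauge νX) νY f → ∀ x, (∀ i, (νX i (x i) : ℝ) ≤ K) → νY (f x) ≤ B := by
  have hK : 0 < |K| + 1 := by positivity
  -- The modulus is applied at `ε = 1 / (|K| + 1)` to the pair `(x, x)`, so that only its bound on
  -- the gauge of the value matters.
  refine ⟨(δ.toFun (|K| + 1)⁻¹)⁻¹.toNNReal, fun {m X Y _ _ νX νY f} h x hx => ?_⟩
  have hx' : (prodGauge νX x : ℝ) < (|K| + 1)⁻¹⁻¹ := by
    rw [inv_inv, prodGauge_lt_iff hK]
    exact fun i => (hx i).trans_lt ((le_abs_self K).trans_lt (lt_add_one _))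
  refine NNReal.le_toNNReal_of_coe_le (h _ (by positivity) x x hx' hx' ?_).2
  rw [dist_self]
  exact δ.pos _ (by positivity)

/-- The gauge axiom bounds each ball in a way that depends on the structure; uniformity comes from
the modulus of the distance symbol. -/
theorem UStructure.exists_nndist_le (s : L.Sorts) (K : ℝ) :
    ∃ B : ℝ≥0, ∀ (M : UStructure.{u} L) (a b : M.carrier s),
      (M.nu s a : ℝ) ≤ K → (M.nu s b : ℝ) ≤ K → nndist a b ≤ B := by
  obtain ⟨B, hB⟩ := exists_gauge_le_of_respects.{u, 0} (L.distMod s) K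
  refine ⟨B, fun M a b ha hb => ?_⟩
  exact hB (M.dist_respects s) ![a, b] (by simp [Fin.forall_fin_two, ha, hb])

theorem exists_uniform_bound {m : ℕ} {p : Fin m → ℝ → Prop}
    (hp : ∀ k, ∃ B, p k B) (hmono : ∀ k B B', B ≤ B' → p k B → p k B') : ∃ B, ∀ k, p k B := by
  choose B hB using hp
  obtain ⟨C, hC⟩ := Set.finite_range B |>.bddAbove
  exact ⟨C, fun k => hmono k _ _ (hC ⟨k, rfl⟩) (hB k)⟩

theorem Term.exists_gauge_le {s : L.Sorts} (t : Term L σ s) (K : ℝ) :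
    ∃ B : ℝ, ∀ (M : UStructure.{u} L) (v : ∀ i, Option (M.carrier (σ i))),
      (∀ i, ∀ b ∈ v i, (M.nu _ b : ℝ) ≤ K) → ∀ b ∈ t.eval M v, (M.nu _ b : ℝ) ≤ B := by
  induction t with
  | var i => exact ⟨K, fun M v hv => hv i⟩
  | app f ts ih =>
    obtain ⟨C, hC⟩ := exists_uniform_bound ih
      fun k B B' hB h M v hv b hb => (h M v hv b hb).trans hB
    obtain ⟨B, hB⟩ := exists_gauge_le_of_respects.{u, u} (L.fnMod f) C
    refine ⟨B, fun M v hv b hb => ?_⟩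
    obtain ⟨x, hx, rfl⟩ := Option.map_eq_some_iff.1 hb
    rw [allSome_eq_some_iff] at hx
    exact hB (M.fn_respects f) x fun k => hC k M v hv _ (hx k)

theorem Term.eval_congr (M : UStructure.{u} L) {i : Fin n} {v v' : ∀ i, Option (M.carrier (σ i))}
    (hv : ∀ j, j ≠ i → v j = v' j) {s : L.Sorts} (t : Term L σ s) (ht : ¬ t.Occurs i) :
    t.eval M v = t.eval M v' := by
  induction t with
  | var j => exact hv j fun h => ht h.symm
  | app f ts ih =>
    simp only [Term.eval]
    congr 2
    funext k
    exact ih k fun h => ht ⟨k, h⟩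

namespace PreFormula

theorem eval_sub_of_forall_ne (M : UStructure.{u} L) (φ ψ : PreFormula L σ)
    (v : ∀ i, Option (M.carrier (σ i))) (h : ¬ ∃ i, v i = none ∧ ψ = .gauge (.var i)) :
    (φ.sub ψ).eval M v = φ.eval M v - ψ.eval M v := by
  rw [eval, if_neg h]

theorem eval_sub_of_eq_none (M : UStructure.{u} L) (φ ψ : PreFormula L σ)
    (v : ∀ i, Option (M.carrier (σ i))) (h : ∃ i, v i = none ∧ ψ = .gauge (.var i)) :
    (φ.sub ψ).eval M v = 0 := by
  rw [eval, if_pos h]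

theorem eval_sub_le (M : UStructure.{u} L) (φ ψ : PreFormula L σ)
    (v : ∀ i, Option (M.carrier (σ i))) : (φ.sub ψ).eval M v ≤ φ.eval M v := by
  rw [eval]
  split_ifs
  · exact zero_le
  · exact tsub_le_self

/-- A syntactically bounded expression is bounded, uniformly in all structures. -/
theorem Bounded.exists_le {φ : PreFormula L σ} (h : φ.Bounded) :
    ∃ B : ℝ≥0, ∀ (M : UStructure.{u} L) v, φ.eval M v ≤ B := by
  induction φ with
  | rel | dist | gauge => exact h.elim
  | one => exact ⟨1, fun M v => le_rfl⟩
  | sub φ ψ ih _ =>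
    obtain ⟨B, hB⟩ := ih h
    exact ⟨B, fun M v => (eval_sub_le M φ ψ v).trans (hB M v)⟩
  | add φ ψ ih ih' =>
    obtain ⟨B, hB⟩ := ih h.1
    obtain ⟨B', hB'⟩ := ih' h.2
    exact ⟨B + B', fun M v => add_le_add (hB M v) (hB' M v)⟩
  | half φ ih =>
    obtain ⟨B, hB⟩ := ih h
    exact ⟨B, fun M v => (half_le_self zero_le).trans (hB M v)⟩
  | sup s φ ih =>
    obtain ⟨B, hB⟩ := ih h
    exact ⟨B, fun M v => ciSup_le fun b => hB M _⟩
  | inf s φ ih =>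
    obtain ⟨B, hB⟩ := ih h
    exact ⟨B, fun M v => ciInf_le_of_le (OrderBot.bddBelow _) none (hB M _)⟩

/-- An expression that is syntactically eventually constant in `xᵢ` takes its value at `xᵢ = ∞` as
soon as the gauge of `xᵢ` is large, uniformly in all structures. -/
theorem EventuallyConst.exists_eval_eq {φ : PreFormula L σ} {i : Fin n}
    (h : φ.EventuallyConst i) :
    ∃ K : ℝ, ∀ (M : UStructure.{u} L) (v v' : ∀ i, Option (M.carrier (σ i))),
      (∀ j, j ≠ i → v j = v' j) → v' i = none → (∀ b ∈ v i, K ≤ M.nu _ b) →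
        φ.eval M v = φ.eval M v' := by
  induction φ with
  | rel R ts =>
    refine ⟨0, fun M v v' hv _ _ => ?_⟩
    simp only [eval]
    congr 3
    funext k
    exact (ts k).eval_congr M hv (h k)
  | dist t t' =>
    refine ⟨0, fun M v v' hv _ _ => ?_⟩
    simp only [eval, t.eval_congr M hv h.1, t'.eval_congr M hv h.2]
  | gauge t =>
    refine ⟨0, fun M v v' hv _ _ => ?_⟩
    simp only [eval, t.eval_congr M hv h]
  | one => exact ⟨0, fun M v v' _ _ _ => rfl⟩
  | @sub _ σ φ ψ ih ih' =>
    rcases h with ⟨h₁, h₂⟩ | ⟨hb, rfl⟩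
    · obtain ⟨K, hK⟩ := ih h₁
      obtain ⟨K', hK'⟩ := ih' h₂
      refine ⟨max K K', fun M v v' hv hn hi => ?_⟩
      -- The clause that forces the value `0` applies to `v` exactly when it applies to `v'`: if `ψ`
      -- is `ν(xⱼ)`, then `j ≠ i`, and the assignments agree at `j`.
      have e : (∃ j, v j = none ∧ ψ = .gauge (.var j)) ↔
          ∃ j, v' j = none ∧ ψ = .gauge (.var j) := by
        refine exists_congr fun j => and_congr_left ?_
        rintro rfl
        rw [hv j fun hj => h₂ hj.symm]
      by_cases hc : ∃ j, v j = none ∧ ψ = .gauge (.var j)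
      · rw [eval_sub_of_eq_none M φ ψ v hc, eval_sub_of_eq_none M φ ψ v' (e.1 hc)]
      · rw [eval_sub_of_forall_ne M φ ψ v hc, eval_sub_of_forall_ne M φ ψ v' (mt e.2 hc),
          hK M v v' hv hn fun b hb => (le_max_left _ _).trans (hi b hb),
          hK' M v v' hv hn fun b hb => (le_max_right _ _).trans (hi b hb)]
    · obtain ⟨B, hB⟩ := hb.exists_le
      -- A bound of `φ` serves as the threshold: once `ν(xᵢ) ≥ B ≥ φ`, the truncated difference
      -- vanishes.
      refine ⟨B, fun M v v' _ hn hi => ?_⟩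
      rw [eval_sub_of_eq_none M φ _ v' ⟨i, hn, rfl⟩]
      by_cases hc : ∃ j, v j = none ∧ (gauge (.var i) : PreFormula L σ) =
          gauge (s := σ j) (.var j)
      · exact eval_sub_of_eq_none M φ _ v hc
      · rw [eval_sub_of_forall_ne M φ _ v hc]
        cases hvi : v i with
        | none => exact (hc ⟨i, hvi, rfl⟩).elim
        | some b =>
          simp only [eval, Term.eval, hvi, Option.map_some, Option.getD_some]
          exact tsub_eq_zero_of_le ((hB M v).trans (hi b hvi))
  | add φ ψ ih ih' =>
    obtain ⟨K, hK⟩ := ih h.1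
    obtain ⟨K', hK'⟩ := ih' h.2
    refine ⟨max K K', fun M v v' hv hn hi => ?_⟩
    rw [eval, eval, hK M v v' hv hn fun b hb => (le_max_left _ _).trans (hi b hb),
      hK' M v v' hv hn fun b hb => (le_max_right _ _).trans (hi b hb)]
  | half φ ih =>
    obtain ⟨K, hK⟩ := ih h
    exact ⟨K, fun M v v' hv hn hi => by rw [eval, eval, hK M v v' hv hn hi]⟩
  | sup s φ ih =>
    obtain ⟨K, hK⟩ := ih h
    refine ⟨K, fun M v v' hv hn hi => iSup_congr fun b => hK M _ _ (fun j => ?_) hn hi⟩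
    cases j using Fin.cases with
    | zero => exact fun _ => rfl
    | succ j => exact fun hj => hv j fun h => hj (congrArg _ h)
  | inf s φ ih =>
    obtain ⟨K, hK⟩ := ih h
    refine ⟨K, fun M v v' hv hn hi => iInf_congr fun b => hK M _ _ (fun j => ?_) hn hi⟩
    cases j using Fin.cases with
    | zero => exact fun _ => rfl
    | succ j => exact fun hj => hv j fun h => hj (congrArg _ h)

/-- The case of the variable bound by a quantifier. -/
theorem EventuallyConst.exists_extendVal_eq {s : L.Sorts} {φ : PreFormula L (extend s σ)}
    (h : φ.EventuallyConst 0) :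
    ∃ K : ℝ, ∀ (M : UStructure.{u} L) (v : ∀ i, Option (M.carrier (σ i))) (b : M.carrier s),
      K ≤ M.nu s b → φ.eval M (extendVal M (some b) v) = φ.eval M (extendVal M none v) := by
  obtain ⟨K, hK⟩ := h.exists_eval_eq
  refine ⟨K, fun M v b hb => hK M _ _ (fun j hj => ?_) rfl ?_⟩
  · cases j using Fin.cases with
    | zero => exact (hj rfl).elim
    | succ j => rfl
  · intro c hc
    obtain rfl : b = c := Option.some_inj.1 hc
    exact hb

/-- The value of a formula is bounded on sets of bounded gauge, uniformly in all structures. -/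
theorem IsFormula.exists_le {φ : PreFormula L σ} (h : φ.IsFormula) (K : ℝ) :
    ∃ B : ℝ≥0, ∀ (M : UStructure.{u} L) (v : ∀ i, Option (M.carrier (σ i))),
      (∀ i, ∀ b ∈ v i, (M.nu _ b : ℝ) ≤ K) → φ.eval M v ≤ B := by
  induction φ generalizing K with
  | rel R ts =>
    obtain ⟨C, hC⟩ := exists_uniform_bound (fun k => (ts k).exists_gauge_le K)
      fun k B B' hB h M v hv b hb => (h M v hv b hb).trans hB
    obtain ⟨B, hB⟩ := exists_gauge_le_of_respects.{u, 0} (L.relMod R) C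
    refine ⟨B, fun M v hv => ?_⟩
    simp only [eval]
    cases hx : allSome fun k => (ts k).eval M v with
    | none => exact zero_le
    | some x =>
      rw [allSome_eq_some_iff] at hx
      exact hB (M.rel_respects R) x fun k => hC k M v hv _ (hx k)
  | @dist _ _ s t t' =>
    obtain ⟨C, hC⟩ := t.exists_gauge_le K
    obtain ⟨C', hC'⟩ := t'.exists_gauge_le K
    obtain ⟨B, hB⟩ := UStructure.exists_nndist_le s (max C C')
    refine ⟨B, fun M v hv => ?_⟩
    simp only [eval]
    split
    · next a b ha hb =>
      exact hB M a b ((hC M v hv a ha).trans (le_max_left _ _))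
        ((hC' M v hv b hb).trans (le_max_right _ _))
    · exact zero_le
  | gauge t =>
    obtain ⟨C, hC⟩ := t.exists_gauge_le K
    refine ⟨C.toNNReal, fun M v hv => ?_⟩
    simp only [eval]
    cases ht : t.eval M v with
    | none => exact zero_le
    | some b => exact NNReal.le_toNNReal_of_coe_le (hC M v hv b ht)
  | one => exact ⟨1, fun M v _ => le_rfl⟩
  | sub φ ψ ih _ =>
    obtain ⟨B, hB⟩ := ih h.1 K
    exact ⟨B, fun M v hv => (eval_sub_le M φ ψ v).trans (hB M v hv)⟩
  | add φ ψ ih ih' =>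
    obtain ⟨B, hB⟩ := ih h.1 K
    obtain ⟨B', hB'⟩ := ih' h.2 K
    exact ⟨B + B', fun M v hv => add_le_add (hB M v hv) (hB' M v hv)⟩
  | half φ ih =>
    obtain ⟨B, hB⟩ := ih h K
    exact ⟨B, fun M v hv => (half_le_self zero_le).trans (hB M v hv)⟩
  | sup s φ ih =>
    obtain ⟨K', hK'⟩ := h.2.exists_extendVal_eq
    -- Values of the bound variable of gauge beyond `K'` contribute nothing new, since they give the
    -- value at `∞`.
    obtain ⟨B, hB⟩ := ih h.1 (max K K')
    have hB' : ∀ (M : UStructure.{u} L) v (b : Option (M.carrier s)),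
        (∀ i, ∀ b ∈ v i, (M.nu _ b : ℝ) ≤ K) → (∀ c ∈ b, (M.nu _ c : ℝ) ≤ K') →
          φ.eval M (extendVal M b v) ≤ B := by
      refine fun M v b hv hb => hB M _ fun i => ?_
      cases i using Fin.cases with
      | zero => exact fun c hc => (hb c hc).trans (le_max_right _ _)
      | succ i => exact fun c hc => (hv i c hc).trans (le_max_left _ _)
    refine ⟨B, fun M v hv => ciSup_le fun b => ?_⟩
    cases b with
    | none => exact hB' M v none hv (by simp)
    | some b =>
      rcases le_total (M.nu s b : ℝ) K' with hb | hb
      · exact hB' M v _ hv (by simpa using hb)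
      · rw [hK' M v b hb]
        exact hB' M v none hv (by simp)
  | inf s φ ih =>
    obtain ⟨B, hB⟩ := ih h.1 K
    refine ⟨B, fun M v hv => ciInf_le_of_le (OrderBot.bddBelow _) none (hB M _ fun i => ?_)⟩
    cases i using Fin.cases with
    | zero => exact fun c hc => (Option.some_ne_none c hc.symm).elim
    | succ i => exact fun c hc => hv i c hc

/-- Needed because `⨆` in `ℝ≥0` is meaningful only for bounded families. A single assignment has
finitely many entries, so some gauge bound always holds for it. -/
theorem IsFormula.bddAbove_range {s : L.Sorts} {φ : PreFormula L (extend s σ)}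
    (h : φ.IsFormula) (hc : φ.EventuallyConst 0) (M : UStructure.{u} L)
    (v : ∀ i, Option (M.carrier (σ i))) :
    BddAbove (Set.range fun b => φ.eval M (extendVal M b v)) := by
  obtain ⟨K, hK⟩ := hc.exists_extendVal_eq
  obtain ⟨K', hK'⟩ : ∃ K' : ℝ, ∀ i, ∀ b ∈ v i, (M.nu _ b : ℝ) ≤ K' := by
    refine exists_uniform_bound (fun i => ?_) fun k B B' hB h b hb => (h b hb).trans hB
    cases v i with
    | none => exact ⟨0, by simp⟩
    | some b => exact ⟨M.nu _ b, by simp⟩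
  obtain ⟨B, hB⟩ := h.exists_le (max K K')
  have hB' : ∀ b : Option (M.carrier s), (∀ c ∈ b, (M.nu _ c : ℝ) ≤ K) →
      φ.eval M (extendVal M b v) ≤ B := by
    refine fun b hb => hB M _ fun i => ?_
    cases i using Fin.cases with
    | zero => exact fun c hc => (hb c hc).trans (le_max_left _ _)
    | succ i => exact fun c hc => (hK' i c hc).trans (le_max_right _ _)
  refine ⟨B, ?_⟩
  rintro _ ⟨b, rfl⟩
  cases b with
  | none => exact hB' none (by simp)
  | some b =>
    rcases le_total (M.nu s b : ℝ) K with hb | hb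
    · exact hB' _ (by simpa using hb)
    · change φ.eval M (extendVal M (some b) v) ≤ B
      rw [hK M v b hb]
      exact hB' none (by simp)

end PreFormula

/-! ### Limits along an ultrafilter -/

section Ulim

variable {I : Type*} (U : Ultrafilter I)

/-- The limit of a bounded family along an ultrafilter. -/
def ulim (f : I → ℝ≥0) : ℝ≥0 := limUnder (U : Filter I) f

variable {U}

theorem tendsto_ulim {f : I → ℝ≥0} {B : ℝ≥0} (h : ∀ᶠ i in U, f i ≤ B) :
    Tendsto f U (𝓝 (ulim U f)) := by
  obtain ⟨x, -, hx⟩ := (isCompact_Icc (a := (0 : ℝ≥0)) (b := B)).ultrafilter_le_nhds' (U.map f)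
    (h.mono fun i hi => ⟨zero_le, hi⟩ : ∀ᶠ i in U, f i ∈ Set.Icc 0 B)
  exact tendsto_nhds_limUnder ⟨x, hx⟩

theorem ulim_eq {f : I → ℝ≥0} {x : ℝ≥0} (h : Tendsto f U (𝓝 x)) : ulim U f = x := h.limUnder_eq

end Ulim

/-! ### Sequences of points of `X ∪ {∞}` -/

section Option

variable {X : Type*} [MetricSpace X]

/-- The distance of two points of `X ∪ {∞}`, with the placeholder `0` at `∞`. -/
def optDist : Option X → Option X → ℝ≥0
  | some a, some b => nndist a b
  | _, _ => 0

@[simp] theorem optDist_some (a b : X) : optDist (some a) (some b) = nndist a b := rfl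

@[simp] theorem optDist_self (a : Option X) : optDist a a = 0 := by
  cases a <;> simp [optDist]

theorem optDist_comm (a b : Option X) : optDist a b = optDist b a := by
  cases a <;> cases b <;> simp [optDist, nndist_comm]

/-- The first `m + 1` points of the sequence are finite, and rapidly approach each other. -/
def Controlled (u : ℕ → Option X) (m : ℕ) : Prop :=
  ∀ k ≤ m, (∃ a, u k = some a) ∧ (k < m → (optDist (u k) (u (k + 1)) : ℝ) ≤ 2 / 2 / 2 ^ k)

theorem Controlled.mono {u : ℕ → Option X} {m m' : ℕ} (h : Controlled u m) (hm : m' ≤ m) :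
    Controlled u m' :=
  fun k hk => ⟨(h k (hk.trans hm)).1, fun hk' => (h k (hk.trans hm)).2 (hk'.trans_le hm)⟩

/-- A sequence has a point close to all terms of its longest controlled initial segment. -/
theorem exists_dist_le_of_controlled [CompleteSpace X] (u : ℕ → Option X) :
    ∃ y : Option X, ∀ m, Controlled u m →
      ∃ a b, u m = some a ∧ y = some b ∧ dist a b ≤ 2 / 2 ^ m := by
  classical
  by_cases h0 : Controlled u 0
  · obtain ⟨x, hx⟩ := (h0 0 le_rfl).1
    -- `g k` is the last controlled index up to `k`. Freezing the sequence once control is lost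
    -- makes it Cauchy, without changing the controlled part.
    let g := fun k => Nat.findGreatest (Controlled u) k
    have hg : ∀ k, Controlled u (g k) := fun k => Nat.findGreatest_spec (Nat.zero_le k) h0
    have hg' : ∀ k, Controlled u k → g k = k := fun k hk =>
      le_antisymm (Nat.findGreatest_le k) (Nat.le_findGreatest le_rfl hk)
    choose w hw using fun k => (hg k (g k) le_rfl).1
    have hd : ∀ k, dist (w k) (w (k + 1)) ≤ 2 / 2 / 2 ^ k := by
      intro k
      by_cases hk : Controlled u (k + 1)
      · have h1 := hw k
        have h2 := hw (k + 1)
        rw [hg' _ hk] at h2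
        rw [hg' _ (hk.mono k.le_succ)] at h1
        simpa [h1, h2] using (hk k k.le_succ).2 k.lt_succ_self
      · have h1 := hw k
        have h2 := hw (k + 1)
        have h3 : g (k + 1) = g k := Nat.findGreatest_of_not hk
        rw [h3, h1, Option.some_inj] at h2
        rw [h2, dist_self]
        positivity
    obtain ⟨b, hb⟩ := cauchySeq_tendsto_of_complete (cauchySeq_of_le_geometric_two hd)
    refine ⟨some b, fun m hm => ⟨w m, b, ?_, rfl, ?_⟩⟩
    · rw [← hw m, hg' m hm]
    · exact dist_le_of_le_geometric_two_of_tendsto hd hb m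
  · exact ⟨none, fun m hm => (h0 (hm.mono m.zero_le)).elim⟩

end Option

/-! ### The ultraproduct of a family of structures -/

section Ultraproduct

variable {I : Type u} (U : Ultrafilter I) (M : I → UStructure.{u} L)

/-- The family `f` consists, along the ultrafilter, of points of bounded gauge. -/
def IsBddSeq (s : L.Sorts) (f : ∀ i, Option ((M i).carrier s)) : Prop :=
  ∃ K : ℝ, ∀ᶠ i in U, ∃ b, f i = some b ∧ ((M i).nu s b : ℝ) ≤ K

/-- The families of bounded gauge. -/
def BddSeq (s : L.Sorts) : Type u := {f : ∀ i, Option ((M i).carrier s) // IsBddSeq U M s f}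

/-- The gauge of a point of `M ∪ {∞}`, with the placeholder `0` at `∞`. -/
def UStructure.optNu (M : UStructure.{u} L) (s : L.Sorts) (a : Option (M.carrier s)) : ℝ≥0 :=
  (a.map (M.nu s)).getD 0

@[simp] theorem UStructure.optNu_some (M : UStructure.{u} L) (s : L.Sorts) (a : M.carrier s) :
    M.optNu s (some a) = M.nu s a := rfl

variable {U M}

theorem BddSeq.eventually_some {s : L.Sorts} (f : BddSeq U M s) :
    ∀ᶠ i in U, ∃ b, f.1 i = some b :=
  f.2.choose_spec.mono fun _ ⟨b, hb, _⟩ => ⟨b, hb⟩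

theorem BddSeq.tendsto_optDist {s : L.Sorts} (f g : BddSeq U M s) :
    Tendsto (fun i => optDist (f.1 i) (g.1 i)) U (𝓝 (ulim U fun i => optDist (f.1 i) (g.1 i))) := by
  obtain ⟨K, hK⟩ := f.2
  obtain ⟨K', hK'⟩ := g.2
  obtain ⟨B, hB⟩ := UStructure.exists_nndist_le s (max K K')
  refine tendsto_ulim (B := B) ?_
  filter_upwards [hK, hK'] with i ⟨a, ha, hKa⟩ ⟨b, hb, hKb⟩
  rw [ha, hb, optDist_some]
  exact hB (M i) a b (hKa.trans (le_max_left _ _)) (hKb.trans (le_max_right _ _))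

theorem BddSeq.tendsto_optNu {s : L.Sorts} (f : BddSeq U M s) :
    Tendsto (fun i => (M i).optNu s (f.1 i)) U (𝓝 (ulim U fun i => (M i).optNu s (f.1 i))) := by
  obtain ⟨K, hK⟩ := f.2
  refine tendsto_ulim (B := K.toNNReal) ?_
  filter_upwards [hK] with i ⟨a, ha, hKa⟩
  rw [ha]
  exact NNReal.le_toNNReal_of_coe_le hKa

instance (s : L.Sorts) : PseudoMetricSpace (BddSeq U M s) where
  dist f g := (ulim U fun i => optDist (f.1 i) (g.1 i) : ℝ≥0)
  dist_self f := by simp [ulim_eq tendsto_const_nhds]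
  dist_comm f g := by simp only [optDist_comm]
  dist_triangle f g h := by
    rw [← NNReal.coe_add, NNReal.coe_le_coe]
    refine le_of_tendsto_of_tendsto (f.tendsto_optDist h)
      ((f.tendsto_optDist g).add (g.tendsto_optDist h)) ?_
    -- `optDist` violates the triangle inequality at `∞`, so finiteness along the ultrafilter is
    -- essential.
    filter_upwards [f.eventually_some, g.eventually_some, h.eventually_some]
      with i ⟨a, ha⟩ ⟨b, hb⟩ ⟨c, hc⟩
    rw [ha, hb, hc]
    exact nndist_triangle a b c

theorem BddSeq.tendsto_dist {s : L.Sorts} (f g : BddSeq U M s) :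
    Tendsto (fun i => (optDist (f.1 i) (g.1 i) : ℝ)) U (𝓝 (dist f g)) :=
  (NNReal.continuous_coe.tendsto _).comp (f.tendsto_optDist g)

/-- No saturation of the ultrafilter is required. The limit is chosen in each factor from the
longest controlled initial segment there; for fixed `m`, almost all factors are controlled up to
`m`, which gives distance at most `2 / 2 ^ m`. -/
instance (s : L.Sorts) : CompleteSpace (BddSeq U M s) := by
  refine Metric.complete_of_convergent_controlled_sequences (fun m => 2 / 2 / 2 ^ m)
    (fun m => by positivity) fun u hu => ?_
  choose y hy using fun i => exists_dist_le_of_controlled fun m => (u m).1 i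
  have hc : ∀ m, ∀ᶠ i in U, Controlled (fun m => (u m).1 i) m := by
    intro m
    refine (eventually_all_finite (Set.finite_Iic m)).2 fun k _ => ?_
    refine (u k).eventually_some.and ?_
    filter_upwards [((u k).tendsto_dist (u (k + 1))).eventually_lt_const
      (hu k k (k + 1) le_rfl k.le_succ)] with i hi _ using hi.le
  have hb : IsBddSeq U M s y := by
    obtain ⟨K, hK⟩ := (u 0).2
    -- At `m = 0` the limit lies within `2` of the first term, and the gauge is `1`-Lipschitz.
    refine ⟨K + 2, ?_⟩
    filter_upwards [hc 0, hK] with i hi ⟨c, hc, hcK⟩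
    obtain ⟨a, b, ha, hb, hab⟩ := hy i 0 hi
    obtain rfl : a = c := Option.some_inj.1 (ha.symm.trans hc)
    refine ⟨b, hb, ?_⟩
    have h := ((M i).isGauge s).lipschitz.dist_le_mul b a
    rw [NNReal.dist_eq, dist_comm b a] at h
    have h' := (abs_le.1 h).2
    norm_num at hab h'
    linarith
  refine ⟨⟨y, hb⟩, ?_⟩
  have hd : ∀ m, dist (u m) (⟨y, hb⟩ : BddSeq U M s) ≤ 2 / 2 ^ m := by
    intro m
    refine le_of_tendsto ((u m).tendsto_dist _) ?_
    filter_upwards [hc m] with i hi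
    obtain ⟨a, b, ha, hb, hab⟩ := hy i m hi
    simp only [ha, hb, optDist_some]
    exact hab
  refine tendsto_iff_dist_tendsto_zero.2 (squeeze_zero (fun _ => dist_nonneg) hd ?_)
  simpa [div_eq_mul_inv] using
    (tendsto_pow_atTop_nhds_zero_of_lt_one (r := (2 : ℝ)⁻¹) (by norm_num) (by norm_num)).const_mul 2

variable (U M) in
/-- The carriers of the ultraproduct. -/
def UCarrier (s : L.Sorts) : Type u := SeparationQuotient (BddSeq U M s)

instance (s : L.Sorts) : MetricSpace (UCarrier U M s) :=
  inferInstanceAs (MetricSpace (SeparationQuotient (BddSeq U M s)))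

instance (s : L.Sorts) : CompleteSpace (UCarrier U M s) :=
  inferInstanceAs (CompleteSpace (SeparationQuotient (BddSeq U M s)))

/-- The point of the ultraproduct given by a family of bounded gauge. -/
def UCarrier.mk {s : L.Sorts} (f : BddSeq U M s) : UCarrier U M s := SeparationQuotient.mk f

/-- A family that represents a point of the ultraproduct. -/
def UCarrier.rep {s : L.Sorts} (x : UCarrier U M s) : BddSeq U M s :=
  Function.surjInv SeparationQuotient.surjective_mk x

@[simp] theorem UCarrier.mk_rep {s : L.Sorts} (x : UCarrier U M s) : mk x.rep = x :=
  Function.surjInv_eq SeparationQuotient.surjective_mk x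

@[simp] theorem UCarrier.dist_mk {s : L.Sorts} (f g : BddSeq U M s) :
    dist (mk f) (mk g) = dist f g := SeparationQuotient.dist_mk f g

/-- Tuples of families that are close at a given coordinate have close values there. -/
theorem eventually_of_respects {m : ℕ} {dom : Fin m → L.Sorts} {Y : I → Type v}
    [∀ i, MetricSpace (Y i)] {νY : ∀ i, Y i → ℝ≥0}
    {g : ∀ i, (∀ k, (M i).carrier (dom k)) → Y i} {δ : Modulus}
    (hg : ∀ i, Respects δ (prodGauge fun k => (M i).nu (dom k)) (νY i) (g i))
    (F G : ∀ k, BddSeq U M (dom k)) {ε : ℝ} (hε : 0 < ε)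
    (hF : ∀ k, ∀ᶠ i in U, ((M i).optNu _ ((F k).1 i) : ℝ) < ε⁻¹)
    (hG : ∀ k, ∀ᶠ i in U, ((M i).optNu _ ((G k).1 i) : ℝ) < ε⁻¹)
    (hd : ∀ k, dist (F k) (G k) < δ.toFun ε) :
    ∀ᶠ i in U, ∃ x y, (allSome fun k => (F k).1 i) = some x ∧
      (allSome fun k => (G k).1 i) = some y ∧
      dist (g i x) (g i y) ≤ ε ∧ (νY i (g i x) : ℝ) ≤ (δ.toFun ε)⁻¹ := by
  filter_upwards [eventually_all.2 hF, eventually_all.2 hG,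
    eventually_all.2 fun k => (F k).eventually_some,
    eventually_all.2 fun k => (G k).eventually_some,
    eventually_all.2 fun k => ((F k).tendsto_dist (G k)).eventually_lt_const (hd k)]
    with i hF hG hx hy hd
  choose x hx using hx
  choose y hy using hy
  have hε' : 0 < ε⁻¹ := inv_pos.2 hε
  refine ⟨x, y, allSome_eq_some_iff.2 hx, allSome_eq_some_iff.2 hy, hg i ε hε x y ?_ ?_ ?_⟩
  · rw [prodGauge_lt_iff hε']
    exact fun k => by simpa [hx] using hF k
  · rw [prodGauge_lt_iff hε']
    exact fun k => by simpa [hy] using hG k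
  · rw [dist_pi_lt_iff (δ.pos ε hε)]
    exact fun k => by simpa [hx, hy] using hd k

/-- Decreasing `ε` enlarges the range `ν < 1 / ε` on which the modulus speaks, until it contains
finitely many given bounded families. -/
theorem exists_eventually_optNu_lt {m : ℕ} {dom : Fin m → L.Sorts}
    (F G : ∀ k, BddSeq U M (dom k)) {ε : ℝ} (hε : 0 < ε) :
    ∃ ε' : ℝ, 0 < ε' ∧ ε' ≤ ε ∧ (∀ k, ∀ᶠ i in U, ((M i).optNu _ ((F k).1 i) : ℝ) < ε'⁻¹) ∧
      ∀ k, ∀ᶠ i in U, ((M i).optNu _ ((G k).1 i) : ℝ) < ε'⁻¹ := by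
  have key : ∀ F : ∀ k, BddSeq U M (dom k), ∃ K : ℝ, ∀ k,
      ∀ᶠ i in U, ((M i).optNu _ ((F k).1 i) : ℝ) ≤ K := by
    refine fun F => exists_uniform_bound (fun k => ?_)
      fun k B B' hB h => h.mono fun i hi => hi.trans hB
    obtain ⟨K, hK⟩ := (F k).2
    refine ⟨K, ?_⟩
    filter_upwards [hK] with i ⟨b, hb, hbK⟩
    simpa [hb] using hbK
  obtain ⟨K, hK⟩ := key F
  obtain ⟨K', hK'⟩ := key G
  have hpos : 0 < |K| + |K'| + 1 := by positivity
  refine ⟨min ε (|K| + |K'| + 1)⁻¹, lt_min hε (inv_pos.2 hpos), min_le_left _ _, ?_⟩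
  have hle : |K| + |K'| + 1 ≤ (min ε (|K| + |K'| + 1)⁻¹)⁻¹ :=
    (le_inv_comm₀ hpos (lt_min hε (inv_pos.2 hpos))).2 (min_le_right _ _)
  have h1 : K < |K| + |K'| + 1 := by linarith [le_abs_self K, abs_nonneg K']
  have h2 : K' < |K| + |K'| + 1 := by linarith [le_abs_self K', abs_nonneg K]
  exact ⟨fun k => (hK k).mono fun i hi => (hi.trans_lt h1).trans_le hle,
    fun k => (hK' k).mono fun i hi => (hi.trans_lt h2).trans_le hle⟩

/-- Families at distance `0` have values at distance `0`, and bounded values. -/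
theorem eventually_dist_le_of_respects {m : ℕ} {dom : Fin m → L.Sorts} {Y : I → Type v}
    [∀ i, MetricSpace (Y i)] {νY : ∀ i, Y i → ℝ≥0}
    {g : ∀ i, (∀ k, (M i).carrier (dom k)) → Y i} {δ : Modulus}
    (hg : ∀ i, Respects δ (prodGauge fun k => (M i).nu (dom k)) (νY i) (g i))
    (F G : ∀ k, BddSeq U M (dom k)) (hd : ∀ k, dist (F k) (G k) = 0) {ε : ℝ} (hε : 0 < ε) :
    ∃ B : ℝ, ∀ᶠ i in U, ∃ x y, (allSome fun k => (F k).1 i) = some x ∧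
      (allSome fun k => (G k).1 i) = some y ∧
      dist (g i x) (g i y) ≤ ε ∧ (νY i (g i x) : ℝ) ≤ B := by
  obtain ⟨ε', h0, hle, hF, hG⟩ := exists_eventually_optNu_lt F G hε
  refine ⟨_, (eventually_of_respects hg F G h0 hF hG fun k => ?_).mono
    fun i ⟨x, y, hx, hy, hxy, hB⟩ => ⟨x, y, hx, hy, hxy.trans hle, hB⟩⟩
  rw [hd k]
  exact δ.pos _ h0

/-! ### Predicates and functions of the ultraproduct -/

section Pred

variable {m : ℕ} {dom : Fin m → L.Sorts} {P : ∀ i, (∀ k, (M i).carrier (dom k)) → ℝ≥0}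
  {δ : Modulus}

/-- The limit of a family of predicates. -/
def upred (P : ∀ i, (∀ k, (M i).carrier (dom k)) → ℝ≥0) (x : ∀ k, UCarrier U M (dom k)) : ℝ≥0 :=
  ulim U fun i => ((allSome fun k => (x k).rep.1 i).map (P i)).getD 0

/-- Independence of the representatives: two choices are at distance `0`, so by the modulus their
values eventually differ by at most any given `ε`. -/
theorem tendsto_upred_mk
    (hP : ∀ i, Respects δ (prodGauge fun k => (M i).nu (dom k)) id (P i))
    (F : ∀ k, BddSeq U M (dom k)) :
    Tendsto (fun i => ((allSome fun k => (F k).1 i).map (P i)).getD 0) U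
      (𝓝 (upred P fun k => UCarrier.mk (F k))) := by
  have h0 : ∀ k, dist (UCarrier.mk (F k)).rep (F k) = 0 := fun k => by
    rw [← UCarrier.dist_mk, UCarrier.mk_rep, dist_self]
  have hlim : Tendsto (fun i => ((allSome fun k => (UCarrier.mk (F k)).rep.1 i).map (P i)).getD 0) U
      (𝓝 (upred P fun k => UCarrier.mk (F k))) := by
    obtain ⟨B, hB⟩ := eventually_dist_le_of_respects hP _ _ h0 one_pos
    refine tendsto_ulim (B := B.toNNReal) ?_
    filter_upwards [hB] with i ⟨x, y, hx, _, _, hxB⟩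
    rw [hx]
    exact NNReal.le_toNNReal_of_coe_le hxB
  refine tendsto_of_tendsto_of_dist hlim (Metric.tendsto_nhds.2 fun ε hε => ?_)
  obtain ⟨B, hB⟩ := eventually_dist_le_of_respects hP _ _ h0 (half_pos hε)
  filter_upwards [hB] with i ⟨x, y, hx, hy, hxy, _⟩
  rw [hx, hy, Real.dist_0_eq_abs, abs_of_nonneg dist_nonneg]
  exact hxy.trans_lt (half_lt_self hε)

theorem UCarrier.exists_mk_eq (x : ∀ k, UCarrier U M (dom k)) :
    ∃ F : ∀ k, BddSeq U M (dom k), (fun k => UCarrier.mk (F k)) = x :=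
  ⟨fun k => (x k).rep, funext fun k => (x k).mk_rep⟩

variable (U M) in
/-- The gauge of the ultraproduct. -/
def uNu (s : L.Sorts) (x : UCarrier U M s) : ℝ≥0 := ulim U fun i => (M i).optNu s (x.rep.1 i)

theorem tendsto_uNu_mk {s : L.Sorts} (f : BddSeq U M s) :
    Tendsto (fun i => (M i).optNu s (f.1 i)) U (𝓝 (uNu U M s (UCarrier.mk f))) := by
  have h0 : dist (UCarrier.mk f).rep f = 0 := by
    rw [← UCarrier.dist_mk, UCarrier.mk_rep, dist_self]
  refine tendsto_of_tendsto_of_dist (UCarrier.mk f).rep.tendsto_optNu ?_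
  refine squeeze_zero' (Eventually.of_forall fun _ => dist_nonneg) ?_
    (h0 ▸ (UCarrier.mk f).rep.tendsto_dist f)
  filter_upwards [f.eventually_some, (UCarrier.mk f).rep.eventually_some] with i ⟨a, ha⟩ ⟨b, hb⟩
  rw [ha, hb]
  simpa using ((M i).isGauge s).lipschitz.dist_le_mul b a

theorem eventually_optNu_lt {s : L.Sorts} (f : BddSeq U M s) {r : ℝ}
    (h : (uNu U M s (UCarrier.mk f) : ℝ) < r) : ∀ᶠ i in U, ((M i).optNu s (f.1 i) : ℝ) < r :=
  ((NNReal.continuous_coe.tendsto _).comp (tendsto_uNu_mk f)).eventually_lt_const h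

/-- The strict hypotheses on gauges and distances hold eventually in the factors, and the weak
conclusions pass to the limit; hence `δ` is kept unchanged. -/
theorem upred_respects (hP : ∀ i, Respects δ (prodGauge fun k => (M i).nu (dom k)) id (P i)) :
    Respects δ (prodGauge fun k => uNu U M (dom k)) id (upred P) := by
  intro ε hε x y hx hy hd
  have hε' : 0 < ε⁻¹ := inv_pos.2 hε
  obtain ⟨F, rfl⟩ := UCarrier.exists_mk_eq x
  obtain ⟨G, rfl⟩ := UCarrier.exists_mk_eq y
  rw [prodGauge_lt_iff hε'] at hx hy
  rw [dist_pi_lt_iff (δ.pos ε hε)] at hd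
  have h := eventually_of_respects hP F G hε (fun k => eventually_optNu_lt _ (hx k))
    (fun k => eventually_optNu_lt _ (hy k)) fun k => by simpa using hd k
  have hF := tendsto_upred_mk hP F
  have hG := tendsto_upred_mk hP G
  constructor
  · refine le_of_tendsto (hF.dist hG) ?_
    filter_upwards [h] with i ⟨x, y, hx, hy, hxy, _⟩
    rwa [hx, hy]
  · refine le_of_tendsto ((NNReal.continuous_coe.tendsto _).comp hF) ?_
    filter_upwards [h] with i ⟨x, y, hx, hy, _, hB⟩
    rw [Function.comp_apply, hx]
    exact hB

end Pred

section Fn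

variable {m : ℕ} {dom : Fin m → L.Sorts} {cod : L.Sorts}
  {g : ∀ i, (∀ k, (M i).carrier (dom k)) → (M i).carrier cod} {δ : Modulus}

/-- The family of values of a family of functions respecting a common modulus. -/
def BddSeq.map (hg : ∀ i, Respects δ (prodGauge fun k => (M i).nu (dom k)) ((M i).nu cod) (g i))
    (F : ∀ k, BddSeq U M (dom k)) : BddSeq U M cod :=
  ⟨fun i => (allSome fun k => (F k).1 i).map (g i), by
    -- Comparing `F` with itself leaves just the bound on the gauge of the values.
    obtain ⟨B, hB⟩ := eventually_dist_le_of_respects hg F F (fun k => dist_self _) one_pos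
    refine ⟨B, ?_⟩
    filter_upwards [hB] with i ⟨x, _, hx, _, _, hxB⟩
    exact ⟨g i x, by rw [hx]; rfl, hxB⟩⟩

/-- The function of the ultraproduct given by a family of functions. -/
def ufn (hg : ∀ i, Respects δ (prodGauge fun k => (M i).nu (dom k)) ((M i).nu cod) (g i))
    (x : ∀ k, UCarrier U M (dom k)) : UCarrier U M cod :=
  .mk (.map hg fun k => (x k).rep)

theorem ufn_mk (hg : ∀ i, Respects δ (prodGauge fun k => (M i).nu (dom k)) ((M i).nu cod) (g i))
    (F : ∀ k, BddSeq U M (dom k)) :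
    ufn hg (fun k => UCarrier.mk (F k)) = UCarrier.mk (.map hg F) := by
  have h0 : ∀ k, dist (UCarrier.mk (F k)).rep (F k) = 0 := fun k => by
    rw [← UCarrier.dist_mk, UCarrier.mk_rep, dist_self]
  refine dist_le_zero.1 (le_of_forall_gt_imp_ge_of_dense fun ε hε => ?_)
  rw [ufn, UCarrier.dist_mk]
  obtain ⟨B, hB⟩ := eventually_dist_le_of_respects hg _ _ h0 hε
  refine le_of_tendsto (BddSeq.tendsto_dist _ _) ?_
  filter_upwards [hB] with i ⟨x, y, hx, hy, hxy, _⟩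
  simpa [BddSeq.map, hx, hy] using hxy

theorem ufn_respects
    (hg : ∀ i, Respects δ (prodGauge fun k => (M i).nu (dom k)) ((M i).nu cod) (g i)) :
    Respects δ (prodGauge fun k => uNu U M (dom k)) (uNu U M cod) (ufn (U := U) hg) := by
  intro ε hε x y hx hy hd
  have hε' : 0 < ε⁻¹ := inv_pos.2 hε
  obtain ⟨F, rfl⟩ := UCarrier.exists_mk_eq x
  obtain ⟨G, rfl⟩ := UCarrier.exists_mk_eq y
  rw [prodGauge_lt_iff hε'] at hx hy
  rw [dist_pi_lt_iff (δ.pos ε hε)] at hd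
  have h := eventually_of_respects hg F G hε (fun k => eventually_optNu_lt _ (hx k))
    (fun k => eventually_optNu_lt _ (hy k)) fun k => by simpa using hd k
  rw [ufn_mk, ufn_mk, UCarrier.dist_mk]
  constructor
  · refine le_of_tendsto (BddSeq.tendsto_dist _ _) ?_
    filter_upwards [h] with i ⟨x, y, hx, hy, hxy, _⟩
    simpa [BddSeq.map, hx, hy] using hxy
  · refine le_of_tendsto ((NNReal.continuous_coe.tendsto _).comp (tendsto_uNu_mk _)) ?_
    filter_upwards [h] with i ⟨x, y, hx, hy, _, hB⟩
    simpa [BddSeq.map, hx] using hB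

end Fn

/-- Viewing the distance as a limit of predicates lets `upred_respects` supply its modulus;
`uNu_eq_upred` does this for the gauge. -/
theorem uDist_eq_upred (s : L.Sorts) :
    (fun x : Fin 2 → UCarrier U M s => nndist (x 0) (x 1)) =
      upred (dom := fun _ : Fin 2 => s) fun _ x => nndist (x 0) (x 1) := by
  funext x
  obtain ⟨F, rfl⟩ := UCarrier.exists_mk_eq x
  refine tendsto_nhds_unique (f := fun i => optDist ((F 0).1 i) ((F 1).1 i)) (l := U) ?_
    ((tendsto_upred_mk (fun i => (M i).dist_respects s) F).congr' ?_)
  · have h : nndist (UCarrier.mk (F 0)) (UCarrier.mk (F 1)) =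
        ulim U fun i => optDist ((F 0).1 i) ((F 1).1 i) :=
      NNReal.eq (by rw [coe_nndist, UCarrier.dist_mk]; rfl)
    rw [h]
    exact (F 0).tendsto_optDist (F 1)
  · filter_upwards [eventually_all.2 fun k => (F k).eventually_some] with i hx
    choose x hx using hx
    rw [allSome_eq_some_iff.2 hx, hx, hx]
    rfl

theorem uNu_eq_upred (s : L.Sorts) :
    (fun x : Fin 1 → UCarrier U M s => uNu U M s (x 0)) =
      upred (dom := fun _ : Fin 1 => s) fun i x => (M i).nu s (x 0) := by
  funext x
  obtain ⟨F, rfl⟩ := UCarrier.exists_mk_eq x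
  refine tendsto_nhds_unique (tendsto_uNu_mk (F 0))
    ((tendsto_upred_mk (fun i => (M i).gauge_respects s) F).congr' ?_)
  filter_upwards [eventually_all.2 fun k => (F k).eventually_some] with i hx
  choose x hx using hx
  rw [allSome_eq_some_iff.2 hx, hx]
  rfl

theorem uDist_respects (s : L.Sorts) :
    Respects (L.distMod s) (prodGauge fun _ : Fin 2 => uNu U M s) id
      (fun x : Fin 2 → UCarrier U M s => nndist (x 0) (x 1)) := by
  rw [uDist_eq_upred]
  exact upred_respects fun i => (M i).dist_respects s

theorem uNu_respects (s : L.Sorts) :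
    Respects (L.gaugeMod s) (prodGauge fun _ : Fin 1 => uNu U M s) id
      (fun x : Fin 1 → UCarrier U M s => uNu U M s (x 0)) := by
  rw [uNu_eq_upred]
  exact upred_respects fun i => (M i).gauge_respects s

theorem uNu_isGauge (s : L.Sorts) : IsGauge (uNu U M s) where
  lipschitz := LipschitzWith.of_dist_le_mul fun x y => by
    rw [NNReal.coe_one, one_mul, ← x.mk_rep, ← y.mk_rep]
    refine le_of_tendsto_of_tendsto ((tendsto_uNu_mk x.rep).dist (tendsto_uNu_mk y.rep))
      (x.rep.tendsto_dist y.rep) ?_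
    filter_upwards [x.rep.eventually_some, y.rep.eventually_some] with i ⟨a, ha⟩ ⟨b, hb⟩
    rw [ha, hb]
    simpa using ((M i).isGauge s).lipschitz.dist_le_mul a b
  bounded r := by
    -- Boundedness of balls in the factors need not be uniform, so the modulus of the distance
    -- symbol is used instead.
    obtain ⟨B, hB⟩ := exists_gauge_le_of_respects.{u, 0} (L.distMod s) r
    refine Metric.isBounded_iff.2 ⟨B, fun x hx y hy => ?_⟩
    exact hB (uDist_respects (U := U) (M := M) s) ![x, y] (Fin.forall_fin_two.2 ⟨hx, hy⟩)

variable (U M) in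
/-- The ultraproduct of a family of structures. -/
def ultraproduct : UStructure.{u} L where
  carrier := UCarrier U M
  nu := uNu U M
  isGauge := uNu_isGauge
  fn f := ufn fun i => (M i).fn_respects f
  rel R := upred fun i => (M i).rel R
  fn_respects f := ufn_respects fun i => (M i).fn_respects f
  rel_respects R := upred_respects fun i => (M i).rel_respects R
  dist_respects := uDist_respects
  gauge_respects := uNu_respects

end Ultraproduct

/-! ### The theorem of Łoś -/

section Los

variable {I : Type u} {U : Ultrafilter I} {M : I → UStructure.{u} L}

/-- The family `f` represents the point `x` of `N ∪ {∞}`, where `N` is the ultraproduct. -/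
def Represents {s : L.Sorts} (f : ∀ i, Option ((M i).carrier s))
    (x : Option ((ultraproduct U M).carrier s)) : Prop :=
  (x = none ∧ ∀ᶠ i in U, f i = none) ∨ ∃ h : IsBddSeq U M s f, x = some (UCarrier.mk ⟨f, h⟩)

theorem exists_represents {s : L.Sorts} (x : Option ((ultraproduct U M).carrier s)) :
    ∃ f, Represents f x := by
  cases x with
  | none => exact ⟨fun _ => none, .inl ⟨rfl, .of_forall fun _ => rfl⟩⟩
  | some x => exact ⟨_, .inr ⟨(UCarrier.rep x).2, congrArg some (UCarrier.mk_rep x).symm⟩⟩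

/-- Ensures that the special clause for `φ ∸ ν(x)` at `∞` applies in the ultraproduct exactly when
it does in almost all factors. -/
theorem Represents.eventually_eq_none_iff {s : L.Sorts} {f : ∀ i, Option ((M i).carrier s)}
    {x : Option ((ultraproduct U M).carrier s)} (h : Represents f x) :
    ∀ᶠ i in U, f i = none ↔ x = none := by
  rcases h with ⟨rfl, h⟩ | ⟨h, rfl⟩
  · exact h.mono fun i hi => iff_of_true hi rfl
  · obtain ⟨K, hK⟩ := h
    exact hK.mono fun i ⟨b, hb, _⟩ => by simp [hb]

/-- A family of bounded gauge where it is finite represents a point. -/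
theorem exists_represents_of_bounded {s : L.Sorts} (f : ∀ i, Option ((M i).carrier s)) (K : ℝ)
    (hf : ∀ i, ∀ b ∈ f i, ((M i).nu s b : ℝ) ≤ K) :
    ∃ x : Option ((ultraproduct U M).carrier s), Represents f x := by
  rcases U.em fun i => f i = none with h | h
  · exact ⟨none, .inl ⟨rfl, h⟩⟩
  · refine ⟨some (UCarrier.mk ⟨f, K, ?_⟩), .inr ⟨_, rfl⟩⟩
    filter_upwards [h] with i hi
    obtain ⟨b, hb⟩ := Option.ne_none_iff_exists'.1 hi
    exact ⟨b, hb, hf i b hb⟩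

theorem allSome_represents {m : ℕ} {dom : Fin m → L.Sorts}
    {f : ∀ k, ∀ i, Option ((M i).carrier (dom k))}
    {x : ∀ k, Option ((ultraproduct U M).carrier (dom k))} (h : ∀ k, Represents (f k) (x k)) :
    (∃ F : ∀ k, BddSeq U M (dom k), (∀ k, (F k).1 = f k) ∧
      allSome x = some fun k => UCarrier.mk (F k)) ∨
    (allSome x = none ∧ ∀ᶠ i in U, (allSome fun k => f k i) = none) := by
  by_cases hx : ∃ k, x k = none
  · obtain ⟨k, hk⟩ := hx
    refine .inr ⟨Option.eq_none_iff_forall_ne_some.2 fun y hy => ?_, ?_⟩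
    · rw [allSome_eq_some_iff] at hy
      simp [hy k] at hk
    · filter_upwards [(h k).eventually_eq_none_iff] with i hi
      refine Option.eq_none_iff_forall_ne_some.2 fun y hy => ?_
      rw [allSome_eq_some_iff] at hy
      exact Option.some_ne_none _ ((hy k).symm.trans (hi.2 hk))
  · have h' : ∀ k, ∃ h : IsBddSeq U M (dom k) (f k), x k = some (UCarrier.mk ⟨f k, h⟩) :=
      fun k => (h k).resolve_left fun hk => hx ⟨k, hk.1⟩
    choose hf hfx using h'
    exact .inl ⟨fun k => ⟨f k, hf k⟩, fun k => rfl, allSome_eq_some_iff.2 hfx⟩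

theorem Represents.term_eval {V : ∀ j, ∀ i, Option ((M i).carrier (σ j))}
    {v : ∀ j, Option ((ultraproduct U M).carrier (σ j))} (h : ∀ j, Represents (V j) (v j))
    {s : L.Sorts} (t : Term L σ s) :
    Represents (fun i => t.eval (M i) fun j => V j i) (t.eval (ultraproduct U M) v) := by
  induction t with
  | var j => exact h j
  | app f ts ih =>
    rcases allSome_represents ih with ⟨F, hF, hx⟩ | ⟨hx, he⟩
    · have hF' : (BddSeq.map (fun i => (M i).fn_respects f) F).1 =
          fun i => (Term.app f ts).eval (M i) fun j => V j i := by
        funext i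
        simp only [BddSeq.map, Term.eval, hF]
      refine .inr ⟨hF' ▸ (BddSeq.map (fun i => (M i).fn_respects f) F).2, ?_⟩
      exact (congrArg (Option.map _) hx).trans (congrArg some <| (ufn_mk (fun i => (M i).fn_respects f) F).trans
        (congrArg UCarrier.mk (Subtype.ext hF')))
    · refine .inl ⟨?_, ?_⟩
      · simp only [Term.eval]
        rw [hx, Option.map_none]
      · filter_upwards [he] with i hi
        simp only [Term.eval]
        rw [hi, Option.map_none]

theorem Represents.extendVal {V : ∀ j, ∀ i, Option ((M i).carrier (σ j))}
    {v : ∀ j, Option ((ultraproduct U M).carrier (σ j))} (h : ∀ j, Represents (V j) (v j))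
    {s : L.Sorts} {f : ∀ i, Option ((M i).carrier s)}
    {x : Option ((ultraproduct U M).carrier s)} (hf : Represents f x) (j : Fin (n + 1)) :
    Represents (s := extend s σ j)
      (fun i => UnboundedLogic.extendVal (M i) (f i) (fun j => V j i) j)
      (UnboundedLogic.extendVal (ultraproduct U M) x v j) := by
  cases j using Fin.cases with
  | zero => exact hf
  | succ j => exact h j

/-- In a formula that is eventually constant in a variable, every family of values of this variable
can be replaced by one that represents a point of the ultraproduct. -/
theorem PreFormula.EventuallyConst.exists_represents {s : L.Sorts}
    {φ : PreFormula L (extend s σ)} (h : φ.EventuallyConst 0)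
    (V : ∀ j, ∀ i, Option ((M i).carrier (σ j))) (f : ∀ i, Option ((M i).carrier s)) :
    ∃ (g : ∀ i, Option ((M i).carrier s)) (x : Option ((ultraproduct U M).carrier s)),
      Represents g x ∧ ∀ i, φ.eval (M i) (UnboundedLogic.extendVal (M i) (g i) fun j => V j i) =
        φ.eval (M i) (UnboundedLogic.extendVal (M i) (f i) fun j => V j i) := by
  obtain ⟨K, hK⟩ := h.exists_extendVal_eq
  -- Witnesses beyond the threshold are sent to `∞`; what stays finite has gauge at most `K`.
  have key : ∀ i, ∃ b : Option ((M i).carrier s), (∀ c ∈ b, ((M i).nu s c : ℝ) ≤ K) ∧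
      φ.eval (M i) (UnboundedLogic.extendVal (M i) b fun j => V j i) =
        φ.eval (M i) (UnboundedLogic.extendVal (M i) (f i) fun j => V j i) := by
    intro i
    cases f i with
    | none => exact ⟨none, by simp, rfl⟩
    | some b =>
      rcases le_total ((M i).nu s b : ℝ) K with hb | hb
      · exact ⟨some b, by simpa using hb, rfl⟩
      · exact ⟨none, by simp, (hK (M i) _ b hb).symm⟩
  choose g hg hgf using key
  obtain ⟨x, hx⟩ := exists_represents_of_bounded (U := U) g K hg
  exact ⟨g, x, hx, hgf⟩

theorem PreFormula.eval_dist (M : UStructure.{u} L) {s : L.Sorts} (t t' : Term L σ s)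
    (v : ∀ i, Option (M.carrier (σ i))) :
    (dist t t').eval M v = optDist (t.eval M v) (t'.eval M v) := by
  simp only [eval]
  cases t.eval M v <;> cases t'.eval M v <;> rfl

/-- The theorem of Łoś for unbounded continuous logic. -/
theorem PreFormula.IsFormula.tendsto_eval {φ : PreFormula L σ} (hφ : φ.IsFormula)
    {V : ∀ j, ∀ i, Option ((M i).carrier (σ j))}
    {v : ∀ j, Option ((ultraproduct U M).carrier (σ j))} (h : ∀ j, Represents (V j) (v j)) :
    Tendsto (fun i => φ.eval (M i) fun j => V j i) U (𝓝 (φ.eval (ultraproduct U M) v)) := by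
  induction φ with
  | rel R ts =>
    rcases allSome_represents fun k => Represents.term_eval h (ts k) with ⟨F, hF, hx⟩ | ⟨hx, he⟩
    · have := tendsto_upred_mk (fun i => (M i).rel_respects R) F
      simp only [eval]
      rw [hx]
      simp only [hF] at this
      exact this
    · simp only [eval]
      rw [hx]
      refine tendsto_const_nhds.congr' ?_
      filter_upwards [he] with i hi
      rw [hi]
      rfl
  | dist t t' =>
    simp only [eval_dist]
    rcases Represents.term_eval h t with ⟨hx, he⟩ | ⟨hb, hx⟩
    · rw [hx]
      refine tendsto_const_nhds.congr' ?_
      filter_upwards [he] with i hi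
      rw [hi]
      rfl
    rcases Represents.term_eval h t' with ⟨hx', he⟩ | ⟨hb', hx'⟩
    · rw [hx, hx']
      refine tendsto_const_nhds.congr' ?_
      filter_upwards [he] with i hi
      rw [hi, optDist_comm]
      rfl
    · rw [hx, hx']
      have hd := BddSeq.tendsto_optDist (U := U) ⟨_, hb⟩ ⟨_, hb'⟩
      have he : nndist (UCarrier.mk ⟨_, hb⟩) (UCarrier.mk ⟨_, hb'⟩) = ulim U _ :=
        NNReal.eq (UCarrier.dist_mk _ _)
      rw [← he] at hd
      exact hd
  | gauge t =>
    simp only [eval]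
    rcases Represents.term_eval h t with ⟨hx, he⟩ | ⟨hb, hx⟩
    · rw [hx]
      refine tendsto_const_nhds.congr' ?_
      filter_upwards [he] with i hi
      rw [hi]
      rfl
    · rw [hx]
      exact tendsto_uNu_mk ⟨_, hb⟩
  | one => exact tendsto_const_nhds
  | sub φ ψ ih ih' =>
    have he := eventually_all.2 fun j => (h j).eventually_eq_none_iff
    by_cases hc : ∃ j, v j = none ∧ ψ = .gauge (.var j)
    · rw [eval_sub_of_eq_none _ φ ψ v hc]
      refine tendsto_const_nhds.congr' ?_
      filter_upwards [he] with i hi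
      obtain ⟨j, hj, hψ⟩ := hc
      exact (eval_sub_of_eq_none _ φ ψ _ ⟨j, (hi j).2 hj, hψ⟩).symm
    · rw [eval_sub_of_forall_ne _ φ ψ v hc]
      refine ((ih hφ.1 h).sub (ih' hφ.2 h)).congr' ?_
      filter_upwards [he] with i hi
      exact (eval_sub_of_forall_ne _ φ ψ _ fun ⟨j, hj, hψ⟩ => hc ⟨j, (hi j).1 hj, hψ⟩).symm
  | add φ ψ ih ih' => exact (ih hφ.1 h).add (ih' hφ.2 h)
  | half φ ih => exact (ih hφ h).div_const 2
  | sup s φ ih =>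
    simp only [eval]
    refine tendsto_order.2 ⟨fun a ha => ?_, fun a ha => ?_⟩
    · obtain ⟨x, hx⟩ := exists_lt_of_lt_ciSup ha
      obtain ⟨f, hf⟩ := UnboundedLogic.exists_represents x
      filter_upwards [(ih hφ.1 (Represents.extendVal h hf)).eventually_const_lt hx] with i hi
      exact hi.trans_le (le_ciSup (hφ.1.bddAbove_range hφ.2 (M i) _) (f i))
    · obtain ⟨c, hc, hca⟩ := exists_between ha
      -- If the suprema were at least `a` along the ultrafilter, witnesses of value above `c` could
      -- be chosen and made to represent a point `x`. In the limit the value at `x` is at least `c`,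
      -- hence exceeds the supremum; the gap between `c` and the supremum absorbs the loss of
      -- strictness.
      by_contra hcon
      rw [← Ultrafilter.eventually_not] at hcon
      have hex : ∀ i, ∃ b, a ≤ (⨆ b, φ.eval (M i) (UnboundedLogic.extendVal (M i) b fun j => V j i)) →
          c < φ.eval (M i) (UnboundedLogic.extendVal (M i) b fun j => V j i) := by
        intro i
        by_cases hi : a ≤ ⨆ b, φ.eval (M i) (UnboundedLogic.extendVal (M i) b fun j => V j i)
        · obtain ⟨b, hb⟩ := exists_lt_of_lt_ciSup (hca.trans_le hi)
          exact ⟨b, fun _ => hb⟩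
        · exact ⟨none, fun hi' => (hi hi').elim⟩
      choose f hf using hex
      obtain ⟨g, x, hg, hgf⟩ := hφ.2.exists_represents (U := U) V f
      refine (lt_of_lt_of_le hc (ge_of_tendsto (ih hφ.1 (Represents.extendVal h hg)) ?_)).not_ge
        (le_ciSup (hφ.1.bddAbove_range hφ.2 (ultraproduct U M) v) x)
      filter_upwards [hcon] with i hi
      rw [hgf]
      exact (hf i (not_lt.1 hi)).le
  | inf s φ ih =>
    simp only [eval]
    refine tendsto_order.2 ⟨fun a ha => ?_, fun a ha => ?_⟩
    · obtain ⟨c, hca, hc⟩ := exists_between ha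
      -- As for suprema, with the inequalities reversed.
      by_contra hcon
      rw [← Ultrafilter.eventually_not] at hcon
      have hex : ∀ i, ∃ b, (⨅ b, φ.eval (M i) (UnboundedLogic.extendVal (M i) b fun j => V j i)) ≤ a →
          φ.eval (M i) (UnboundedLogic.extendVal (M i) b fun j => V j i) < c := by
        intro i
        by_cases hi : (⨅ b, φ.eval (M i) (UnboundedLogic.extendVal (M i) b fun j => V j i)) ≤ a
        · obtain ⟨b, hb⟩ := exists_lt_of_ciInf_lt (hi.trans_lt hca)
          exact ⟨b, fun _ => hb⟩
        · exact ⟨none, fun hi' => (hi hi').elim⟩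
      choose f hf using hex
      obtain ⟨g, x, hg, hgf⟩ := hφ.2.exists_represents (U := U) V f
      refine (lt_of_le_of_lt (le_of_tendsto (ih hφ.1 (Represents.extendVal h hg)) ?_) hc).not_ge
        (ciInf_le (OrderBot.bddBelow _) x)
      filter_upwards [hcon] with i hi
      rw [hgf]
      exact (hf i (not_lt.1 hi)).le
    · obtain ⟨x, hx⟩ := exists_lt_of_ciInf_lt ha
      obtain ⟨f, hf⟩ := UnboundedLogic.exists_represents x
      filter_upwards [(ih hφ.1 (Represents.extendVal h hf)).eventually_lt_const hx] with i hi
      exact (ciInf_le (OrderBot.bddBelow _) (f i)).trans_lt hi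

/-- A family of tuples of bounded gauge has a limit in the ultraproduct. -/
theorem exists_tendsto_value (a : ∀ i, ∀ j, (M i).carrier (σ j)) (K : ℝ)
    (ha : ∀ j, ∀ᶠ i in U, ((M i).nu _ (a i j) : ℝ) ≤ K) :
    ∃ b : ∀ j, (ultraproduct U M).carrier (σ j), ∀ φ : Formula L σ,
      Tendsto (fun i => φ.value (M i) (a i)) U (𝓝 (φ.value (ultraproduct U M) b)) :=
  ⟨fun j => UCarrier.mk ⟨fun i => some (a i j), K, (ha j).mono fun _ hi => ⟨_, rfl, hi⟩⟩,
    fun φ => φ.2.tendsto_eval fun _ => .inr ⟨_, rfl⟩⟩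

theorem models_ultraproduct {T : Theory L} (h : ∀ i, T.Models (M i)) :
    T.Models (ultraproduct U M) := by
  intro c hc
  have := c.formula.2.tendsto_eval (U := U) (M := M) (V := fun j => j.elim0)
    (v := fun j => some (j.elim0 : (ultraproduct U M).carrier (Fin.elim0 j))) fun j => j.elim0
  refine le_of_tendsto ((NNReal.continuous_coe.tendsto _).comp this)
    (.of_forall fun i => le_of_eq_of_le ?_ (h i c hc))
  simp only [Function.comp_apply, Formula.value]
  congr 2
  funext j
  exact j.elim0

end Los

/-! ### Bounded compactness -/

theorem Satisfiable.approxFinitelySatisfiable {C : Set (Condition L σ)} (h : Satisfiable C) :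
    ApproxFinitelySatisfiable C := by
  obtain ⟨M, a, ha⟩ := h
  rintro w hw - ε hε
  refine ⟨M, a, ?_⟩
  rintro _ ⟨c, hc, rfl⟩
  exact (ha c (hw hc)).trans (le_add_of_nonneg_right hε.le)

theorem ApproxFinitelySatisfiable.satisfiable {C : Set (Condition L σ)}
    (h : ApproxFinitelySatisfiable C) (r : ℝ≥0) (hr : ∀ j, gaugeLe σ j r ∈ C) :
    Satisfiable C := by
  classical
  let I : Type u := Finset C × ℕ
  have hI : ∀ i : I, ∃ (M : UStructure.{u} L) (a : ∀ j, M.carrier (σ j)),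
      ∀ c ∈ i.1, (c.1.formula.value M a : ℝ) ≤ c.1.bound + 1 / (i.2 + 1 : ℝ) := by
    intro i
    obtain ⟨M, a, ha⟩ := h (Subtype.val '' (i.1 : Set C)) (by rintro _ ⟨c, -, rfl⟩; exact c.2)
      (i.1.finite_toSet.image _) (1 / (i.2 + 1 : ℝ)) Nat.one_div_pos_of_nat
    exact ⟨M, a, fun c hc => ha _ ⟨c.1, ⟨c, hc, rfl⟩, rfl⟩⟩
  choose M a ha using hI
  -- Along such an ultrafilter, every condition is eventually included and every tolerance
  -- eventually met.
  let U : Ultrafilter I := Ultrafilter.of atTop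
  have hU : (U : Filter I) ≤ atTop := Ultrafilter.of_le _
  have hev : ∀ c ∈ C, ∀ ε : ℝ, 0 < ε → ∀ᶠ i in U,
      (c.formula.value (M i) (a i) : ℝ) ≤ c.bound + ε := by
    intro c hc ε hε
    obtain ⟨m, hm⟩ := exists_nat_one_div_lt hε
    refine hU ?_
    filter_upwards [eventually_ge_atTop (({⟨c, hc⟩}, m) : I)] with i hi
    refine (ha i ⟨c, hc⟩ (hi.1 (Finset.mem_singleton_self _))).trans ?_
    have : 1 / (i.2 + 1 : ℝ) ≤ 1 / (m + 1) := Nat.one_div_le_one_div hi.2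
    simp only
    linarith
  -- The gauge conditions at tolerance `1` make the tuples bounded; the exact bound `r` is recovered
  -- in the limit with all other conditions.
  obtain ⟨b, hb⟩ := exists_tendsto_value (U := U) a (r + 1) fun j => hev _ (hr j) 1 one_pos
  refine ⟨ultraproduct U M, b, fun c hc => le_of_forall_pos_le_add fun ε hε => ?_⟩
  exact le_of_tendsto ((NNReal.continuous_coe.tendsto _).comp (hb c.formula)) (hev c hc ε hε)

/-! ### Local compactness of type spaces -/

/-- The natural number `k` as a formula. -/
def PreFormula.natConst (σ : Fin n → L.Sorts) : ℕ → PreFormula L σ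
  | 0 => .sub .one .one
  | k + 1 => .add (natConst σ k) .one

theorem PreFormula.isFormula_natConst (k : ℕ) : (natConst σ k).IsFormula := by
  induction k with
  | zero => exact ⟨trivial, trivial⟩
  | succ k ih => exact ⟨ih, trivial⟩

theorem PreFormula.eval_natConst (M : UStructure.{u} L) (k : ℕ)
    (v : ∀ i, Option (M.carrier (σ i))) : (natConst σ k).eval M v = k := by
  induction k with
  | zero => simp [natConst, eval]
  | succ k ih => simp [natConst, eval, ih]

/-- The condition `φ ≥ t`, as `k ∸ φ ≤ k - t` for a natural number `k ≥ t`. -/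
def Condition.ge (φ : Formula L σ) (t : ℝ≥0) : Condition L σ :=
  ⟨⟨.sub (.natConst σ ⌈t⌉₊) φ.1, PreFormula.isFormula_natConst _, φ.2⟩, ⌈t⌉₊ - t⟩

theorem Condition.holds_ge {φ : Formula L σ} {t : ℝ≥0} {M : UStructure.{u} L}
    {a : ∀ i, M.carrier (σ i)} : (Condition.ge φ t).Holds M a ↔ t ≤ φ.value M a := by
  have h : (Condition.ge φ t).formula.value M a = ⌈t⌉₊ - φ.value M a := by
    simp only [Condition.ge, Formula.value]
    rw [PreFormula.eval_sub_of_forall_ne _ _ _ _ (by simp), PreFormula.eval_natConst]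
  have ht : (t : ℝ) ≤ ⌈t⌉₊ := by exact_mod_cast Nat.le_ceil t
  rw [Condition.Holds, h, NNReal.coe_sub_def, ← NNReal.coe_le_coe, NNReal.coe_natCast]
  change max _ _ ≤ (⌈t⌉₊ - t : ℝ) ↔ _
  rw [max_le_iff, sub_le_sub_iff_left]
  -- Truncation at `0` is harmless because `⌈t⌉₊ ≥ t` makes the bound nonnegative.
  exact and_iff_left (sub_nonneg.2 ht)

namespace TypeSpace

variable {T : Theory L}

/-- The type of a tuple in a model of the theory. -/
def ofTuple (M : UStructure.{u} L) (hM : T.Models M) (a : ∀ i, M.carrier (σ i)) :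
    TypeSpace T σ :=
  ⟨typeOf M a, M, hM, a, rfl⟩

theorem exists_eq_ofTuple (p : TypeSpace T σ) : ∃ M hM a, p = ofTuple M hM a := by
  obtain ⟨M, hM, a, h⟩ := p.2
  exact ⟨M, hM, a, Subtype.ext h⟩

theorem isOpen_notMem (c : Condition L σ) : IsOpen {p : TypeSpace T σ | c ∉ p.1} :=
  TopologicalSpace.isOpen_generateFrom_of_mem ⟨c, rfl⟩

/-- For `t` strictly between the two values of the formula, `φ < t` and `φ > t` define the
separating open sets; the first is open thanks to `Condition.ge`. -/
theorem exists_disjoint_of_notMem {p q : TypeSpace T σ} {c : Condition L σ} (hp : c ∈ p.1)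
    (hq : c ∉ q.1) : ∃ u v : Set (TypeSpace T σ),
      IsOpen u ∧ IsOpen v ∧ p ∈ u ∧ q ∈ v ∧ Disjoint u v := by
  obtain ⟨M, _, a, rfl⟩ := p.exists_eq_ofTuple
  obtain ⟨N, _, b, rfl⟩ := q.exists_eq_ofTuple
  have hlt : c.formula.value M a < c.formula.value N b :=
    NNReal.coe_lt_coe.1 (lt_of_le_of_lt hp (not_le.1 hq))
  obtain ⟨t, ht, ht'⟩ := exists_between hlt
  refine ⟨_, _, isOpen_notMem (Condition.ge c.formula t), isOpen_notMem ⟨c.formula, t⟩,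
    fun h => ht.not_ge (Condition.holds_ge.1 h),
    fun h => ht'.not_ge (NNReal.coe_le_coe.1 h), Set.disjoint_left.2 ?_⟩
  intro p h h'
  obtain ⟨M', _, a', rfl⟩ := p.exists_eq_ofTuple
  exact (le_total t (c.formula.value M' a')).elim (fun hle => h (Condition.holds_ge.2 hle))
    fun hle => h' (NNReal.coe_le_coe.2 hle)

instance : T2Space (TypeSpace T σ) where
  t2 p q hpq := by
    have hne : p.1 ≠ q.1 := fun h => hpq (Subtype.ext h)
    by_cases h : p.1 ⊆ q.1
    · obtain ⟨c, hq, hp⟩ := Set.not_subset.1 fun h' => hne (h.antisymm h')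
      obtain ⟨u, v, hu, hv, hqu, hpv, huv⟩ := exists_disjoint_of_notMem hq hp
      exact ⟨v, u, hv, hu, hpv, hqu, huv.symm⟩
    · obtain ⟨c, hp, hq⟩ := Set.not_subset.1 h
      exact exists_disjoint_of_notMem hp hq

/-- The types of tuples of gauge at most `r` form a compact set. -/
theorem isCompact_gaugeLe (r : ℝ≥0) :
    IsCompact {p : TypeSpace T σ | ∀ j, gaugeLe σ j r ∈ p.1} := by
  refine isCompact_iff_ultrafilter_le_nhds.2 fun U hU => ?_
  choose M hM a ha using fun p : TypeSpace T σ => p.exists_eq_ofTuple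
  have hr : ∀ j, ∀ᶠ p in (U : Filter (TypeSpace T σ)), ((M p).nu _ (a p j) : ℝ) ≤ r := by
    intro j
    filter_upwards [le_principal_iff.1 hU] with p hp
    have := hp j
    rw [ha p] at this
    exact this
  -- The type space itself is the index set, each type being the index of a chosen realisation of
  -- it.
  obtain ⟨b, hb⟩ := exists_tendsto_value a r hr
  refine ⟨ofTuple (ultraproduct U M) (models_ultraproduct hM) b, fun j => ?_, ?_⟩
  · exact le_of_tendsto ((NNReal.continuous_coe.tendsto _).comp (hb (gaugeLe σ j r).formula)) (hr j)
  · rw [TopologicalSpace.nhds_generateFrom]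
    refine le_iInf₂ fun s hs => le_principal_iff.2 ?_
    obtain ⟨hs, c, rfl⟩ := hs
    filter_upwards [((NNReal.continuous_coe.tendsto _).comp (hb c.formula)).eventually_const_lt
      (not_le.1 fun h => hs h)] with p hp
    change c ∉ p.1
    rw [ha p]
    exact not_le.2 hp

/-- With `r` strictly above the gauge of the tuple, the open conditions `ν(xⱼ) < r` cut out a
neighbourhood inside the compact set. -/
instance : WeaklyLocallyCompactSpace (TypeSpace T σ) where
  exists_compact_mem_nhds p := by
    obtain ⟨M, hM, a, rfl⟩ := p.exists_eq_ofTuple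
    obtain ⟨r, hr⟩ := exists_gt (prodGauge (fun j => M.nu (σ j)) a)
    refine ⟨_, isCompact_gaugeLe r, ?_⟩
    have hev : ∀ j, ∀ᶠ p in 𝓝 (ofTuple M hM a),
        Condition.ge (gaugeLe σ j r).formula r ∉ p.1 := fun j =>
      (isOpen_notMem _).mem_nhds fun h => (Condition.holds_ge.1 h).not_gt
        ((Finset.le_sup (f := fun j => M.nu (σ j) (a j)) (Finset.mem_univ j)).trans_lt hr)
    filter_upwards [eventually_all.2 hev] with p hp j
    obtain ⟨N, _, b, rfl⟩ := p.exists_eq_ofTuple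
    exact NNReal.coe_le_coe.2 (not_le.1 fun h => hp j (Condition.holds_ge.2 h)).le

end TypeSpace

end UnboundedLogic

end

theorem mainTheorem4 (L : UnboundedLogic.Signature.{u}) :
    (∀ (n : ℕ) (σ : Fin n → L.Sorts) (r : ℝ≥0) (C : Set (UnboundedLogic.Condition L σ)),
      UnboundedLogic.Satisfiable (C ∪ Set.range fun i => UnboundedLogic.gaugeLe σ i r) ↔
        UnboundedLogic.ApproxFinitelySatisfiable
          (C ∪ Set.range fun i => UnboundedLogic.gaugeLe σ i r)) ∧
    (∀ (T : UnboundedLogic.Theory L) (n : ℕ) (σ : Fin n → L.Sorts),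
      LocallyCompactSpace (UnboundedLogic.TypeSpace T σ)) :=
  ⟨fun _ _ r _ => ⟨UnboundedLogic.Satisfiable.approxFinitelySatisfiable,
    -- The Hausdorff property upgrades one compact neighbourhood per point to local compactness.
    fun h => h.satisfiable r fun j => .inr ⟨j, rfl⟩⟩, fun _ _ _ => inferInstance⟩
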